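/- Equip $\mathbb{H}^{3}$, regarded as a right vector space of column vectors over the quaternions $\mathbb{H}$, with the Hermitian form $\langle p,q\rangle=q^{*}Jp$ of signature $(2,1)$, where $J=\begin{pmatrix}0&0&1\\0&1&0\\1&0&0\end{pmatrix}$, and let $\mathbf{Sp}(2,1)$ be the group of invertible quaternionic $3\times3$ matrices $A$ with $A^{*}JA=J$. It acts on quaternionic hyperbolic $2$-space $\mathbf{H}^2_{\mathbb{H}}$, the set of negative lines $p\,\mathbb{H}$ in the projective plane, whose boundary is the set of null lines. The standard totally geodesic submanifolds are the sets of those points of $\mathbf{H}^2_{\mathbb{H}}$ that have a representative $p=(p_1,p_2,p_3)^t$ with: $p_2=0$ (quaternionic line); $p\in\mathbb{C}^3$ and $p_2=0$ (complex line); $p\in\mathbb{C}^3$ (the complex plane $\mathbf{H}^2_{\mathbb{C}}$); $p\in\mathbb{R}^3$ (the real plane $\mathbf{H}^2_{\mathbb{R}}$). A quaternionic line, a complex line, a copy of $\mathbf{H}^2_{\mathbb{C}}$, a copy of $\mathbf{H}^2_{\mathbb{R}}$ is an image of the respective standard one under an element of $\mathbf{Sp}(2,1)$. A subgroup of $\mathbf{Sp}(2,1)$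 is Fuchsian if it leaves invariant a set of one of these four kinds. It is Kleinian if it is discrete, and a Kleinian group is non-elementary if its limit set (the set of accumulation points in the boundary of orbits of points of $\mathbf{H}^2_{\mathbb{H}}$) has more than two points. Theorem. Let $G\subset\mathbf{Sp}(2,1)$ be a non-elementary quaternionic hyperbolic Kleinian group such that the trace (the sum of the diagonal entries) of every element of $G$ is real. Then $G$ is Fuchsian. More precisely, there is $C\in\mathbf{Sp}(2,1)$ such that at least one of the following holds: (i) $G$ leaves invariant the quaternionic line that is the image under $C$ of the standard one, and every element of $C^{-1}GC$ has the form $\begin{pmatrix}a&0&c\\0&e&0\\g&0&l\end{pmatrix}$; (ii) $G$ leaves invariant the image under $C$ of the standard real plane $\mathbf{H}^2_{\mathbb{R}}$, and every element of $C^{-1}GC$ is, up to sign, a matrix in $\mathbf{SO}(2,1)=\{M\in M_3(\mathbb{R}): M^{t}JM=J,\ \det M=1\}$. -/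

import Mathlib

open scoped Quaternion Matrix LinearAlgebra.Projectivization Pointwise Topology

noncomputable section

namespace QuatHyp

/-- The matrix `J` of the second Hermitian form of signature `(2,1)`, over any coefficients. -/
def formJ (R : Type) [Zero R] [One R] : Matrix (Fin 3) (Fin 3) R :=
  !![0, 0, 1; 0, 1, 0; 1, 0, 0]

/-- The Hermitian form `⟨p, q⟩ = q* J p` on column vectors in `ℍ³`. -/
def herm (p q : Fin 3 → ℍ[ℝ]) : ℍ[ℝ] :=
  star q ⬝ᵥ (formJ ℍ[ℝ] *ᵥ p)

/-- The group `Sp(2,1)` of invertible quaternionic matrices `A` with `A* J A = J`. -/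
def Sp21 : Subgroup (GL (Fin 3) ℍ[ℝ]) where
  carrier := {A | (A : Matrix (Fin 3) (Fin 3) ℍ[ℝ])ᴴ * formJ ℍ[ℝ] *
    (A : Matrix (Fin 3) (Fin 3) ℍ[ℝ]) = formJ ℍ[ℝ]}
  mul_mem' := by
    intro A B hA hB
    simp only [Set.mem_ofPred_eq, Units.val_mul, Matrix.conjTranspose_mul] at *
    calc _ = (B : Matrix (Fin 3) (Fin 3) ℍ[ℝ])ᴴ *
          ((A : Matrix (Fin 3) (Fin 3) ℍ[ℝ])ᴴ * formJ ℍ[ℝ] *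
          (A : Matrix (Fin 3) (Fin 3) ℍ[ℝ])) * (B : Matrix (Fin 3) (Fin 3) ℍ[ℝ]) := by
          simp only [mul_assoc]
      _ = _ := by rw [hA, hB]
  one_mem' := by simp
  inv_mem' := by
    intro A hA
    simp only [Set.mem_ofPred_eq] at *
    have h1 : (A : Matrix (Fin 3) (Fin 3) ℍ[ℝ]) *
        ((A⁻¹ : GL (Fin 3) ℍ[ℝ]) : Matrix (Fin 3) (Fin 3) ℍ[ℝ]) = 1 := A.mul_inv
    have h2 : ((A⁻¹ : GL (Fin 3) ℍ[ℝ]) : Matrix (Fin 3) (Fin 3) ℍ[ℝ])ᴴ *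
        (A : Matrix (Fin 3) (Fin 3) ℍ[ℝ])ᴴ = 1 := by
      rw [← Matrix.conjTranspose_mul, h1, Matrix.conjTranspose_one]
    calc _ = ((A⁻¹ : GL (Fin 3) ℍ[ℝ]) : Matrix (Fin 3) (Fin 3) ℍ[ℝ])ᴴ *
          ((A : Matrix (Fin 3) (Fin 3) ℍ[ℝ])ᴴ * formJ ℍ[ℝ] *
          (A : Matrix (Fin 3) (Fin 3) ℍ[ℝ])) *
          ((A⁻¹ : GL (Fin 3) ℍ[ℝ]) : Matrix (Fin 3) (Fin 3) ℍ[ℝ]) := by rw [hA]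
      _ = (((A⁻¹ : GL (Fin 3) ℍ[ℝ]) : Matrix (Fin 3) (Fin 3) ℍ[ℝ])ᴴ *
          (A : Matrix (Fin 3) (Fin 3) ℍ[ℝ])ᴴ) * formJ ℍ[ℝ] *
          ((A : Matrix (Fin 3) (Fin 3) ℍ[ℝ]) *
          ((A⁻¹ : GL (Fin 3) ℍ[ℝ]) : Matrix (Fin 3) (Fin 3) ℍ[ℝ])) := by
          simp only [mul_assoc]
      _ = _ := by rw [h1, h2, one_mul, mul_one]

/-- The quaternionic projective plane: lines `vℍ` in the right vector space `ℍ³`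
(right multiplication by scalars is the action of the opposite ring). Matrices act on it
from the left by `g • [v] = [g v]`. -/
abbrev HP2 : Type := ℙ ℍ[ℝ]ᵐᵒᵖ (Fin 3 → ℍ[ℝ])

/-- The quotient topology on the projective plane. -/
instance instTopologicalSpaceHP2 : TopologicalSpace HP2 :=
  TopologicalSpace.coinduced
    (fun v : {v : Fin 3 → ℍ[ℝ] // v ≠ 0} => Projectivization.mk ℍ[ℝ]ᵐᵒᵖ v.1 v.2) inferInstance

/-- Quaternionic hyperbolic 2-space: the negative lines. -/
def hypPlane : Set HP2 :=
  {x | ∃ (v : Fin 3 → ℍ[ℝ]) (hv : v ≠ 0),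
    x = Projectivization.mk ℍ[ℝ]ᵐᵒᵖ v hv ∧ (herm v v).re < 0}

/-- The boundary at infinity of quaternionic hyperbolic 2-space: the null lines. -/
def boundary : Set HP2 :=
  {x | ∃ (v : Fin 3 → ℍ[ℝ]) (hv : v ≠ 0),
    x = Projectivization.mk ℍ[ℝ]ᵐᵒᵖ v hv ∧ herm v v = 0}

/-- The limit set: the boundary points at which some orbit of a point of quaternionic
hyperbolic 2-space accumulates. -/
def limitSet (G : Subgroup (GL (Fin 3) ℍ[ℝ])) : Set HP2 :=
  {ξ | ξ ∈ boundary ∧ ∃ z ∈ hypPlane, AccPt ξ (Filter.principal (MulAction.orbit G z))}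

/-- A quaternionic hyperbolic Kleinian group: a discrete subgroup of `Sp(2,1)`. -/
def IsKleinian (G : Subgroup (GL (Fin 3) ℍ[ℝ])) : Prop :=
  G ≤ Sp21 ∧ DiscreteTopology G

/-- A group is elementary if its limit set has at most two points. -/
def IsElementary (G : Subgroup (GL (Fin 3) ℍ[ℝ])) : Prop :=
  (limitSet G).encard ≤ 2

/-- The standard quaternionic line: negative lines orthogonal to the second basis vector. -/
def stdQuaternionicLine : Set HP2 :=
  {x | x ∈ hypPlane ∧ ∃ (v : Fin 3 → ℍ[ℝ]) (hv : v ≠ 0),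
    x = Projectivization.mk ℍ[ℝ]ᵐᵒᵖ v hv ∧ v 1 = 0}

/-- The standard complex line. -/
def stdComplexLine : Set HP2 :=
  {x | x ∈ hypPlane ∧ ∃ (w : Fin 3 → ℂ) (hv : (fun i => (w i : ℍ[ℝ])) ≠ 0),
    x = Projectivization.mk ℍ[ℝ]ᵐᵒᵖ (fun i => (w i : ℍ[ℝ])) hv ∧ w 1 = 0}

/-- The standard complex hyperbolic plane. -/
def stdComplexPlane : Set HP2 :=
  {x | x ∈ hypPlane ∧ ∃ (w : Fin 3 → ℂ) (hv : (fun i => (w i : ℍ[ℝ])) ≠ 0),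
    x = Projectivization.mk ℍ[ℝ]ᵐᵒᵖ (fun i => (w i : ℍ[ℝ])) hv}

/-- The standard real hyperbolic plane. -/
def stdRealPlane : Set HP2 :=
  {x | x ∈ hypPlane ∧ ∃ (w : Fin 3 → ℝ) (hv : (fun i => (w i : ℍ[ℝ])) ≠ 0),
    x = Projectivization.mk ℍ[ℝ]ᵐᵒᵖ (fun i => (w i : ℍ[ℝ])) hv}

/-- `L` is one of the totally geodesic submanifolds of quaternionic hyperbolic 2-space:
a quaternionic line, a complex line, a complex hyperbolic plane or a real hyperbolic plane,
that is, the image of a standard one under an isometry from `Sp(2,1)`. -/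
def IsGeodesicSubmanifold (L : Set HP2) : Prop :=
  ∃ C ∈ Sp21, L = C • stdQuaternionicLine ∨ L = C • stdComplexLine ∨
    L = C • stdComplexPlane ∨ L = C • stdRealPlane

/-- `G` leaves the set `L` invariant. -/
def LeavesInvariant (G : Subgroup (GL (Fin 3) ℍ[ℝ])) (L : Set HP2) : Prop :=
  ∀ g ∈ G, g • L = L

/-- A group is Fuchsian if it leaves invariant one of the totally geodesic submanifolds. -/
def IsFuchsian (G : Subgroup (GL (Fin 3) ℍ[ℝ])) : Prop :=
  ∃ L : Set HP2, IsGeodesicSubmanifold L ∧ LeavesInvariant G L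

/-- The trace of the quaternionic matrix `g`, the sum of its diagonal entries, is real. -/
def HasRealTrace (g : GL (Fin 3) ℍ[ℝ]) : Prop :=
  ∃ r : ℝ, Matrix.trace (g : Matrix (Fin 3) (Fin 3) ℍ[ℝ]) = (r : ℍ[ℝ])

/-- The block form: with rows `(a, b, c)`, `(d, e, f)`, `(g, h, l)`, one has
`b = d = f = h = 0`. -/
def IsBlock (g : GL (Fin 3) ℍ[ℝ]) : Prop :=
  g.val 0 1 = 0 ∧ g.val 1 0 = 0 ∧ g.val 1 2 = 0 ∧ g.val 2 1 = 0

/-- The group `SO(2,1)` of the form `J`, as a set of real matrices. -/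
def SO21 : Set (Matrix (Fin 3) (Fin 3) ℝ) :=
  {M | Mᵀ * formJ ℝ * M = formJ ℝ ∧ M.det = 1}

/-- `g` represents an element of `SO(2,1)` in the projective group: as `g` and `-g` act in the
same way, this says that `g` is plus or minus a matrix in `SO(2,1)`. -/
def InSO21 (g : GL (Fin 3) ℍ[ℝ]) : Prop :=
  ∃ M ∈ SO21, g.val = M.map (fun r : ℝ => (r : ℍ[ℝ])) ∨
    g.val = -M.map (fun r : ℝ => (r : ℍ[ℝ]))

end QuatHyp

end

noncomputable section

namespace QuatHyp

open MulOpposite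

/-! ### Algebra of the Hermitian form -/

/-! The argument turns on whether `G` fixes a point `vℍ` of the projective plane, and on the sign of
`⟨v, v⟩` if it does. If `v` is negative, then `|⟨p, v⟩|²` is invariant and keeps orbits away from
the boundary, so the limit set is empty. If `v` is null, then either no element scales `v` and the
horospheres at `v` are preserved, or some element is loxodromic and discreteness forces all of `G`
to fix its other endpoint (`fixes_second_point`); the limit set then has at most two points. Both
cases are excluded for a non-elementary group. If `v` is positive, its orthogonal complement is an
invariant quaternionic line, which is (i). Discreteness matters only in the null case, and the
traces only in what follows.

If no line is fixed, neither is a plane (take orthogonal complements), so every orbit of a nonzero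
vector spans. The real span `A` of `G` is a real algebra, stable under the adjoint because `adj g =
g⁻¹`, and all its traces are real. The group is unbounded, since a bounded one has no limit points;
rescaled elements therefore accumulate at a nonzero `Y` in `A` with `Y* J Y = 0`. Isotropic
subspaces have dimension at most one, so `Y` is a product `u r` of a null column and a row
(`exists_rank_one`).

The heart is `dotProduct_mulVec_real`: `r a u` is real for every `a` in `A`. Otherwise its imaginary
part `p` would yield a real `3 × 3` matrix whose square is `-|p|²`, which is impossible in odd size.
Products with `Y` and its adjoint then show that the form is real on `A u` up to a common left
factor `d`, and a positive vector of `A u` shows that `d` is real. A frame adapted to `J` can thus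
be chosen inside `A u`; the entries of `G` in that frame are values of the form on `A u`, hence
real, which is (ii). -/

theorem herm_eq (p q : Fin 3 → ℍ[ℝ]) :
    herm p q = star (q 0) * p 2 + star (q 1) * p 1 + star (q 2) * p 0 := by
  simp [herm, formJ, dotProduct, Matrix.mulVec, Fin.sum_univ_three]

theorem herm_add_left (p p' q : Fin 3 → ℍ[ℝ]) : herm (p + p') q = herm p q + herm p' q := by
  simp only [herm_eq, Pi.add_apply, mul_add]; abel

theorem herm_add_right (p q q' : Fin 3 → ℍ[ℝ]) : herm p (q + q') = herm p q + herm p q' := by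
  simp only [herm_eq, Pi.add_apply, star_add, add_mul]; abel

theorem herm_smul_left (h : ℍ[ℝ]) (p q : Fin 3 → ℍ[ℝ]) :
    herm (op h • p) q = herm p q * h := by
  simp only [herm_eq, Pi.smul_apply, op_smul_eq_mul, add_mul, mul_assoc]

theorem herm_smul_right (h : ℍ[ℝ]) (p q : Fin 3 → ℍ[ℝ]) :
    herm p (op h • q) = star h * herm p q := by
  simp only [herm_eq, Pi.smul_apply, op_smul_eq_mul, mul_add, star_mul, mul_assoc]

theorem herm_real_smul_left (t : ℝ) (p q : Fin 3 → ℍ[ℝ]) :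
    herm (t • p) q = t • herm p q := by
  simp only [herm_eq, Pi.smul_apply, smul_add, mul_smul_comm]

theorem herm_zero_left (q : Fin 3 → ℍ[ℝ]) : herm 0 q = 0 := by simp [herm_eq]

theorem herm_zero_right (q : Fin 3 → ℍ[ℝ]) : herm q 0 = 0 := by simp [herm_eq]

theorem star_herm (p q : Fin 3 → ℍ[ℝ]) : star (herm p q) = herm q p := by
  simp only [herm_eq, star_add, star_mul, star_star]; abel

theorem herm_self_eq_coe (p : Fin 3 → ℍ[ℝ]) : herm p p = ((herm p p).re : ℍ[ℝ]) :=
  Quaternion.star_eq_self.mp (star_herm p p)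

theorem herm_eq_zero_comm {p q : Fin 3 → ℍ[ℝ]} : herm p q = 0 ↔ herm q p = 0 := by
  rw [← star_herm, star_eq_zero]

theorem herm_nondegenerate {p : Fin 3 → ℍ[ℝ]} (h : ∀ q, herm p q = 0) : p = 0 := by
  have h0 := h ![1, 0, 0]
  have h1 := h ![0, 1, 0]
  have h2 := h ![0, 0, 1]
  simp [herm_eq] at h0 h1 h2
  funext i
  fin_cases i <;> simp_all

/-- The adjoint of a matrix for the Hermitian form. -/
def adj (a : Matrix (Fin 3) (Fin 3) ℍ[ℝ]) : Matrix (Fin 3) (Fin 3) ℍ[ℝ] :=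
  formJ ℍ[ℝ] * aᴴ * formJ ℍ[ℝ]

theorem formJ_mul_formJ : formJ ℍ[ℝ] * formJ ℍ[ℝ] = 1 := by
  ext i j : 1
  fin_cases i <;> fin_cases j <;> simp [formJ, Matrix.mul_apply, Fin.sum_univ_three]

theorem formJ_conjTranspose : (formJ ℍ[ℝ])ᴴ = formJ ℍ[ℝ] := by
  ext i j : 1
  fin_cases i <;> fin_cases j <;> simp [formJ]

theorem herm_mulVec (a : Matrix (Fin 3) (Fin 3) ℍ[ℝ]) (p q : Fin 3 → ℍ[ℝ]) :
    herm (a *ᵥ p) q = herm p (adj a *ᵥ q) := by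
  have h : star (adj a *ᵥ q) ᵥ* formJ ℍ[ℝ] = star q ᵥ* (formJ ℍ[ℝ] * a) := by
    rw [Matrix.star_mulVec, adj]
    simp only [Matrix.conjTranspose_mul, formJ_conjTranspose, Matrix.conjTranspose_conjTranspose,
      Matrix.vecMul_vecMul]
    rw [mul_assoc, mul_assoc, formJ_mul_formJ, mul_one]
  rw [herm, herm, Matrix.mulVec_mulVec, Matrix.dotProduct_mulVec, ← h, ← Matrix.dotProduct_mulVec]

theorem mem_Sp21_iff {g : GL (Fin 3) ℍ[ℝ]} :
    g ∈ Sp21 ↔ g.valᴴ * formJ ℍ[ℝ] * g.val = formJ ℍ[ℝ] := Iff.rfl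

theorem adj_mul_self {g : GL (Fin 3) ℍ[ℝ]} (hg : g ∈ Sp21) : adj g.val * g.val = 1 := by
  rw [adj, mul_assoc, mul_assoc, ← mul_assoc g.valᴴ, mem_Sp21_iff.mp hg, formJ_mul_formJ]

theorem adj_val {g : GL (Fin 3) ℍ[ℝ]} (hg : g ∈ Sp21) : adj g.val = (g⁻¹).val :=
  left_inv_eq_right_inv (adj_mul_self hg) g.mul_inv

theorem herm_mulVec_mulVec {g : GL (Fin 3) ℍ[ℝ]} (hg : g ∈ Sp21) (p q : Fin 3 → ℍ[ℝ]) :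
    herm (g.val *ᵥ p) (g.val *ᵥ q) = herm p q := by
  rw [herm_mulVec, Matrix.mulVec_mulVec, adj_mul_self hg, Matrix.one_mulVec]

theorem inv_mulVec_mulVec (g : GL (Fin 3) ℍ[ℝ]) (p : Fin 3 → ℍ[ℝ]) :
    (g⁻¹).val *ᵥ (g.val *ᵥ p) = p := by
  rw [Matrix.mulVec_mulVec, g.inv_mul, Matrix.one_mulVec]

theorem mulVec_inv_mulVec (g : GL (Fin 3) ℍ[ℝ]) (p : Fin 3 → ℍ[ℝ]) :
    g.val *ᵥ ((g⁻¹).val *ᵥ p) = p := by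
  rw [Matrix.mulVec_mulVec, g.mul_inv, Matrix.one_mulVec]

theorem mulVec_ne_zero (g : GL (Fin 3) ℍ[ℝ]) {p : Fin 3 → ℍ[ℝ]} (hp : p ≠ 0) :
    g.val *ᵥ p ≠ 0 := fun h => hp (by rw [← inv_mulVec_mulVec g p, h, Matrix.mulVec_zero])

theorem mulVec_op_smul (a : Matrix (Fin 3) (Fin 3) ℍ[ℝ]) (h : ℍ[ℝ]) (p : Fin 3 → ℍ[ℝ]) :
    a *ᵥ (op h • p) = op h • (a *ᵥ p) := Matrix.mulVec_smul _ _ _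

theorem herm_self_smul (h : ℍ[ℝ]) (p : Fin 3 → ℍ[ℝ]) :
    (herm (op h • p) (op h • p)).re = Quaternion.normSq h * (herm p p).re := by
  rw [herm_smul_left, herm_smul_right, herm_self_eq_coe p, mul_assoc, Quaternion.coe_commutes,
    ← mul_assoc, Quaternion.star_mul_self]
  simp

/-! ### Signature -/

theorem re_herm_self (p : Fin 3 → ℍ[ℝ]) : (herm p p).re = Quaternion.normSq (p 1) +
    (Quaternion.normSq (p 0 + p 2) - Quaternion.normSq (p 0 - p 2)) / 2 := by
  simp only [herm_eq, Quaternion.normSq_def', Quaternion.re_add, Quaternion.re_mul,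
    Quaternion.re_star, Quaternion.imI_star, Quaternion.imJ_star, Quaternion.imK_star,
    Quaternion.imI_add, Quaternion.imJ_add, Quaternion.imK_add, Quaternion.re_sub,
    Quaternion.imI_sub, Quaternion.imJ_sub, Quaternion.imK_sub]
  ring

/-- On the subspace `p 0 = p 2` the form equals `|p 1|² + 2 |p 2|²`, so it is positive definite
there. This is how the signature enters: a nonpositive subspace meets this one trivially and so has
dimension at most one. -/
theorem eq_zero_of_nonpos {p : Fin 3 → ℍ[ℝ]} (h02 : p 0 = p 2) (h : (herm p p).re ≤ 0) :
    p = 0 := by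
  rw [re_herm_self, h02, sub_self, map_zero] at h
  have h1 : 0 ≤ Quaternion.normSq (p 1) := Quaternion.normSq_nonneg
  have h2 : 0 ≤ Quaternion.normSq (p 2 + p 2) := Quaternion.normSq_nonneg
  have h3 : p 1 = 0 := Quaternion.normSq_eq_zero.mp (by linarith)
  have h4 : p 2 + p 2 = 0 := Quaternion.normSq_eq_zero.mp (by linarith)
  have h5 : p 2 = 0 := by
    rw [← two_smul ℝ] at h4
    exact (smul_eq_zero.mp h4).resolve_left two_ne_zero
  funext i
  fin_cases i <;> simp [h3, h5, h02]

theorem diff_ne_zero {v : Fin 3 → ℍ[ℝ]} (hv : v ≠ 0) (h : (herm v v).re ≤ 0) :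
    v 0 - v 2 ≠ 0 := fun h02 => hv (eq_zero_of_nonpos (sub_eq_zero.mp h02) h)

/-- A nonpositive vector `v` and a nonpositive vector `x` orthogonal to it are proportional. -/
theorem exists_eq_smul_of_orthogonal {v x : Fin 3 → ℍ[ℝ]} (hv : v ≠ 0)
    (hv0 : (herm v v).re ≤ 0) (hx0 : (herm x x).re ≤ 0) (hxv : herm x v = 0) :
    ∃ c : ℍ[ℝ], x = op c • v := by
  have hl := diff_ne_zero hv hv0
  -- With this `c` the outer coordinates of `x - v c` agree. By orthogonality its norm is a sum of
  -- two nonpositive terms, so it vanishes.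
  set c := (v 0 - v 2)⁻¹ * (x 0 - x 2) with hc
  refine ⟨c, ?_⟩
  have hvx : herm v x = 0 := herm_eq_zero_comm.mp hxv
  have hy : x + op (-c) • v = 0 := by
    apply eq_zero_of_nonpos
    · simp only [Pi.add_apply, Pi.smul_apply, op_smul_eq_mul, mul_neg]
      have : (v 0 - v 2) * c = x 0 - x 2 := by rw [hc, mul_inv_cancel_left₀ hl]
      rw [sub_mul] at this
      rw [← sub_eq_zero]
      rw [← sub_eq_zero] at this
      rw [← neg_eq_zero, ← this]
      abel
    · rw [herm_add_left, herm_add_right, herm_add_right, herm_smul_right, hxv, herm_smul_left, hvx]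
      simp only [mul_zero, zero_mul, add_zero, zero_add, Quaternion.re_add, herm_self_smul]
      have : 0 ≤ Quaternion.normSq (-c) := Quaternion.normSq_nonneg
      nlinarith
  rw [op_neg, neg_smul, ← sub_eq_add_neg, sub_eq_zero] at hy
  exact hy

theorem herm_self_pos_of_orthogonal {v x : Fin 3 → ℍ[ℝ]} (hv : (herm v v).re < 0)
    (hx : x ≠ 0) (hxv : herm x v = 0) : 0 < (herm x x).re := by
  by_contra! h
  have hv0 : v ≠ 0 := by rintro rfl; simp [herm_zero_left] at hv
  obtain ⟨c, rfl⟩ := exists_eq_smul_of_orthogonal hv0 hv.le h hxv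
  rw [herm_smul_left] at hxv
  rcases mul_eq_zero.mp hxv with h1 | h1
  · rw [h1] at hv; simp at hv
  · exact hx (by simp [h1])

/-! ### Adapted frames -/

/-- The Hermitian form as a real linear map in its first argument. -/
def hermL (q : Fin 3 → ℍ[ℝ]) : (Fin 3 → ℍ[ℝ]) →ₗ[ℝ] ℍ[ℝ] where
  toFun p := herm p q
  map_add' p p' := herm_add_left p p' q
  map_smul' t p := herm_real_smul_left t p q

/-- Eight real equations in twelve real unknowns. -/
theorem exists_orthogonal (e y : Fin 3 → ℍ[ℝ]) :
    ∃ f : Fin 3 → ℍ[ℝ], f ≠ 0 ∧ herm f e = 0 ∧ herm f y = 0 := by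
  have hlt : Module.finrank ℝ (ℍ[ℝ] × ℍ[ℝ]) < Module.finrank ℝ (Fin 3 → ℍ[ℝ]) := by
    rw [Module.finrank_prod, Module.finrank_pi_fintype, Fin.sum_univ_three,
      Quaternion.finrank_eq_four]
    norm_num
  have hk := LinearMap.ker_ne_bot_of_finrank_lt (f := (hermL e).prod (hermL y)) hlt
  obtain ⟨f, hf, hf0⟩ := Submodule.exists_mem_ne_zero_of_ne_bot hk
  rw [LinearMap.mem_ker, LinearMap.prod_apply, Function.prod_apply, Prod.mk_eq_zero] at hf
  exact ⟨f, hf0, hf.1, hf.2⟩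

theorem conjTranspose_formJ_mul_apply (C : Matrix (Fin 3) (Fin 3) ℍ[ℝ]) (i j : Fin 3) :
    (Cᴴ * formJ ℍ[ℝ] * C) i j = herm (C.col j) (C.col i) := by
  fin_cases i <;> fin_cases j <;>
    simp [herm_eq, formJ, Matrix.mul_apply, Fin.sum_univ_three, Matrix.col, Matrix.conjTranspose,
      Matrix.transpose] <;> abel

theorem exists_mem_Sp21_of_frame {e f y : Fin 3 → ℍ[ℝ]} (hee : herm e e = 0) (hyy : herm y y = 0)
    (hye : herm y e = 1) (hff : herm f f = 1) (hfe : herm f e = 0) (hfy : herm f y = 0) :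
    ∃ C ∈ Sp21, C.val.col 0 = e ∧ C.val.col 1 = f ∧ C.val.col 2 = y := by
  set C : Matrix (Fin 3) (Fin 3) ℍ[ℝ] := (Matrix.of ![e, f, y])ᵀ with hC
  have h0 : C.col 0 = e := rfl
  have h1 : C.col 1 = f := rfl
  have h2 : C.col 2 = y := rfl
  have hey : herm e y = 1 := by rw [← star_herm, hye, star_one]
  have hef := herm_eq_zero_comm.mp hfe
  have hyf := herm_eq_zero_comm.mp hfy
  have hJ : Cᴴ * formJ ℍ[ℝ] * C = formJ ℍ[ℝ] := by
    ext i j : 1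
    rw [conjTranspose_formJ_mul_apply]
    fin_cases i <;> fin_cases j <;>
      simp [h0, h1, h2, hee, hyy, hye, hff, hfe, hfy, hey, hef, hyf, formJ]
  have hl : adj C * C = 1 := by
    rw [adj, mul_assoc, mul_assoc, ← mul_assoc Cᴴ, hJ, formJ_mul_formJ]
  exact ⟨⟨C, adj C, mul_eq_one_comm.mp hl, hl⟩, hJ, h0, h1, h2⟩

theorem real_smul_eq_op (t : ℝ) (x : Fin 3 → ℍ[ℝ]) : t • x = op (t : ℍ[ℝ]) • x := by
  funext i
  rw [Pi.smul_apply, Pi.smul_apply, op_smul_eq_mul, Quaternion.mul_coe_eq_smul]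

theorem herm_real_smul_right (t : ℝ) (p q : Fin 3 → ℍ[ℝ]) :
    herm p (t • q) = t • herm p q := by
  rw [real_smul_eq_op, herm_smul_right, Quaternion.star_coe, Quaternion.coe_mul_eq_smul]

theorem exists_normalized_of_pos {x : Fin 3 → ℍ[ℝ]} (h : 0 < (herm x x).re) :
    ∃ t : ℝ, herm (t • x) (t • x) = 1 := by
  set s := Real.sqrt (herm x x).re with hs
  have hs0 : 0 < s := Real.sqrt_pos.mpr h
  refine ⟨s⁻¹, ?_⟩
  rw [herm_real_smul_left, herm_real_smul_right, herm_self_eq_coe, ← Real.sq_sqrt h.le, ← hs,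
    ← Quaternion.coe_smul, ← Quaternion.coe_smul, ← Quaternion.coe_one]
  congr 1
  simp only [smul_eq_mul]
  field_simp

/-- The hypothesis `hvs` expresses dually that the negative vector `v` lies in the span of `e` and
`y`; anything orthogonal to both is then positive and can be normalized. -/
theorem exists_normalized_orthogonal {e y v : Fin 3 → ℍ[ℝ]} (hv : (herm v v).re < 0)
    (hvs : ∀ f, herm f e = 0 → herm f y = 0 → herm f v = 0) :
    ∃ f, herm f f = 1 ∧ herm f e = 0 ∧ herm f y = 0 := by
  obtain ⟨f, hf0, hfe, hfy⟩ := exists_orthogonal e y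
  obtain ⟨t, ht⟩ := exists_normalized_of_pos
    (herm_self_pos_of_orthogonal hv hf0 (hvs f hfe hfy))
  exact ⟨t • f, ht, by rw [herm_real_smul_left, hfe, smul_zero],
    by rw [herm_real_smul_left, hfy, smul_zero]⟩

theorem herm_neg_right (p q : Fin 3 → ℍ[ℝ]) : herm p (-q) = -herm p q := by
  simp only [herm_eq, Pi.neg_apply, star_neg]; noncomm_ring

theorem herm_neg_left (p q : Fin 3 → ℍ[ℝ]) : herm (-p) q = -herm p q := by
  simp only [herm_eq, Pi.neg_apply]; noncomm_ring

theorem exists_mem_Sp21_of_null_pair {e y : Fin 3 → ℍ[ℝ]} (hee : herm e e = 0)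
    (hyy : herm y y = 0) (hye : herm y e = 1) :
    ∃ C ∈ Sp21, C.val.col 0 = e ∧ C.val.col 2 = y := by
  have hey : herm e y = 1 := by rw [← star_herm, hye, star_one]
  obtain ⟨f, hff, hfe, hfy⟩ := exists_normalized_orthogonal (e := e) (y := y) (v := e + -y)
    (by simp [herm_add_left, herm_add_right, herm_neg_left, herm_neg_right, hee, hyy, hye, hey])
    (fun f hfe hfy => by rw [herm_add_right, herm_neg_right, hfe, hfy, neg_zero, add_zero])
  obtain ⟨C, hC, h0, -, h2⟩ := exists_mem_Sp21_of_frame hee hyy hye hff hfe hfy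
  exact ⟨C, hC, h0, h2⟩

theorem exists_mem_Sp21_of_pos {v : Fin 3 → ℍ[ℝ]} (hv : 0 < (herm v v).re) :
    ∃ C ∈ Sp21, ∃ t : ℝ, C.val.col 1 = t • v := by
  obtain ⟨t, ht⟩ := exists_normalized_of_pos hv
  set f := t • v with hf
  -- The negative vector `(1, 0, -1)` made orthogonal to `f`; removing its component along the
  -- positive `f` only lowers its norm `-2`.
  set n : Fin 3 → ℍ[ℝ] := ![1, 0, -1] + op (-herm ![1, 0, -1] f) • f with hn
  have hnf : herm n f = 0 := by
    rw [hn, herm_add_left, herm_smul_left, ht, one_mul, add_neg_cancel]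
  have hnn : (herm n n).re < 0 := by
    have h1 : herm ![1, 0, -1] ![1, 0, -1] = (-2 : ℍ[ℝ]) := by
      simp [herm_eq]; norm_num
    have h2 : herm n n = herm n ![1, 0, -1] := by
      conv_lhs => rw [hn, herm_add_right, herm_smul_right, ← hn, hnf, mul_zero, add_zero]
    rw [h2, hn, herm_add_left, herm_smul_left, h1, ← star_herm ![1, 0, -1] f, mul_neg,
      Quaternion.star_mul_self]
    have := Quaternion.normSq_nonneg (a := herm ![1, 0, -1] f)
    have h3 : (2 : ℍ[ℝ]).re = 2 := rfl
    simp only [Quaternion.re_add, Quaternion.re_neg, Quaternion.re_coe, h3]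
    linarith
  obtain ⟨x, hxx, hxn, hxf⟩ := exists_normalized_orthogonal (e := n) (y := f) hnn
    (fun f h _ => h)
  set s := Real.sqrt (-(herm n n).re / 2) with hs
  have hs2 : s * s = -(herm n n).re / 2 := Real.mul_self_sqrt (by linarith)
  have hs0 : s ≠ 0 := by
    intro h; rw [h] at hs2; linarith
  have hnx := herm_eq_zero_comm.mp hxn
  have hfx := herm_eq_zero_comm.mp hxf
  have hfn := herm_eq_zero_comm.mp hnf
  have hN : herm ((2 * s)⁻¹ • n) ((2 * s)⁻¹ • n) = ((-(1 / 2) : ℝ) : ℍ[ℝ]) := by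
    rw [herm_real_smul_left, herm_real_smul_right, herm_self_eq_coe n,
      ← Quaternion.coe_smul, ← Quaternion.coe_smul]
    congr 1
    simp only [smul_eq_mul]
    have : (herm n n).re = -2 * (s * s) := by linarith
    rw [this]
    field_simp
  set r := Real.sqrt (1 / 2) with hr
  have hr2 : r * r = 1 / 2 := Real.mul_self_sqrt (by norm_num)
  have hX : herm (r • x) (r • x) = ((1 / 2 : ℝ) : ℍ[ℝ]) := by
    rw [herm_real_smul_left, herm_real_smul_right, hxx, smul_smul, hr2, ← Quaternion.coe_one,
      ← Quaternion.coe_smul, smul_eq_mul, mul_one]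
  set N := (2 * s)⁻¹ • n
  set X := r • x
  have hXN : herm X N = 0 := by
    rw [herm_real_smul_left, herm_real_smul_right, hxn, smul_zero, smul_zero]
  have hNX := herm_eq_zero_comm.mp hXN
  have hfN : herm f N = 0 := by rw [herm_real_smul_right, hfn, smul_zero]
  have hfX : herm f X = 0 := by rw [herm_real_smul_right, hfx, smul_zero]
  -- Since `X` and `N` are orthogonal of norms `1/2` and `-1/2`, the vectors `X + N` and `X - N` are
  -- null with product `1`.
  obtain ⟨C, hC, -, h1, -⟩ := exists_mem_Sp21_of_frame (e := X + N) (f := f) (y := X + -N)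
    (by simp [herm_add_left, herm_add_right, hX, hN, hXN, hNX])
    (by simp [herm_add_left, herm_add_right, herm_neg_left, herm_neg_right, hX, hN, hXN, hNX])
    (by
      rw [herm_add_left, herm_add_right, herm_add_right, herm_neg_left, herm_neg_left, hX, hN, hXN,
        hNX, Quaternion.coe_neg, neg_neg, neg_zero, add_zero, zero_add, ← Quaternion.coe_add,
        add_halves, Quaternion.coe_one])
    ht
    (by simp [herm_add_right, hfX, hfN])
    (by simp [herm_add_right, herm_neg_right, hfX, hfN])
  exact ⟨C, hC, t, h1⟩

/-! ### Limit sets -/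

theorem mk_eq_mk_of_smul {v w : Fin 3 → ℍ[ℝ]} (hv : v ≠ 0) (hw : w ≠ 0) {h : ℍ[ℝ]}
    (hvw : v = op h • w) :
    Projectivization.mk ℍ[ℝ]ᵐᵒᵖ v hv = Projectivization.mk ℍ[ℝ]ᵐᵒᵖ w hw :=
  (Projectivization.mk_eq_mk_iff' _ _ _ _ _).mpr ⟨op h, hvw.symm⟩

/-- The scaling rule makes the sign of `Ψ` independent of the representative, so the preimage under
the quotient map is just `Ψ ≤ 0`. -/
theorem isClosed_setOf_nonpos {Ψ : (Fin 3 → ℍ[ℝ]) → ℝ} (hc : Continuous Ψ)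
    (hh : ∀ (h : ℍ[ℝ]) v, Ψ (op h • v) = Quaternion.normSq h * Ψ v) :
    IsClosed {x : HP2 | ∃ (v : Fin 3 → ℍ[ℝ]) (hv : v ≠ 0),
      x = Projectivization.mk ℍ[ℝ]ᵐᵒᵖ v hv ∧ Ψ v ≤ 0} := by
  rw [isClosed_coinduced]
  have : (fun v : {v : Fin 3 → ℍ[ℝ] // v ≠ 0} => Projectivization.mk ℍ[ℝ]ᵐᵒᵖ v.1 v.2) ⁻¹'
      {x : HP2 | ∃ (v : Fin 3 → ℍ[ℝ]) (hv : v ≠ 0),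
      x = Projectivization.mk ℍ[ℝ]ᵐᵒᵖ v hv ∧ Ψ v ≤ 0} = {v | Ψ v.1 ≤ 0} := by
    ext ⟨w, hw⟩
    constructor
    · rintro ⟨v, hv, hwv, hΨ⟩
      obtain ⟨a, ha⟩ := (Projectivization.mk_eq_mk_iff' _ _ _ _ _).mp hwv
      change a • v = w at ha
      change Ψ w ≤ 0
      rw [← ha, ← op_unop a, hh]
      exact mul_nonpos_of_nonneg_of_nonpos Quaternion.normSq_nonneg hΨ
    · intro h
      exact ⟨w, hw, rfl, h⟩
  rw [this]
  exact isClosed_le (hc.comp continuous_subtype_val) continuous_const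

theorem continuous_herm_left (q : Fin 3 → ℍ[ℝ]) : Continuous fun p => herm p q := by
  simp only [herm_eq]; fun_prop

theorem continuous_re_herm_self : Continuous fun p : Fin 3 → ℍ[ℝ] => (herm p p).re := by
  simp only [herm_eq]
  exact Quaternion.continuous_re.comp (by fun_prop)

/-- A quasi-invariant function bounds the limit set. -/
theorem exists_rep_of_mem_limitSet {G : Subgroup (GL (Fin 3) ℍ[ℝ])} (hG : G ≤ Sp21)
    {F : (Fin 3 → ℍ[ℝ]) → ℝ} (hc : Continuous F)
    (hh : ∀ (h : ℍ[ℝ]) v, F (op h • v) = Quaternion.normSq h * F v) (K : ℝ)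
    (hF : ∀ g ∈ G, ∀ v, F (g.val *ᵥ v) ≤ K * F v) {ξ : HP2} (hξ : ξ ∈ limitSet G) :
    ∃ (b : Fin 3 → ℍ[ℝ]) (hb : b ≠ 0), ξ = Projectivization.mk ℍ[ℝ]ᵐᵒᵖ b hb ∧
      herm b b = 0 ∧ F b ≤ 0 := by
  obtain ⟨⟨b, hb, hξb, hbb⟩, z, ⟨v, hv, hzv, hneg⟩, hacc⟩ := hξ
  -- This `c` puts the whole orbit of `z` in the closed set `F + c⟨·,·⟩ ≤ 0`, since the form is
  -- invariant and `F` grows at most by the factor `K`. At a null limit point the second term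
  -- disappears, leaving `F ≤ 0`.
  set c : ℝ := K * F v / -(herm v v).re with hcdef
  have hcv : K * F v + c * (herm v v).re = 0 := by
    rw [hcdef]; field_simp [hneg.ne]; ring
  set S := {x : HP2 | ∃ (v : Fin 3 → ℍ[ℝ]) (hv : v ≠ 0),
      x = Projectivization.mk ℍ[ℝ]ᵐᵒᵖ v hv ∧ F v + c * (herm v v).re ≤ 0} with hS
  have hclosed : IsClosed S := isClosed_setOf_nonpos (Ψ := fun v => F v + c * (herm v v).re)
    (hc.add (continuous_const.mul continuous_re_herm_self))
    (fun h v => by rw [hh, herm_self_smul]; ring)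
  have hsub : MulAction.orbit G z ⊆ S := by
    rintro _ ⟨⟨g, hg⟩, rfl⟩
    refine ⟨g.val *ᵥ v, mulVec_ne_zero g hv, ?_, ?_⟩
    · rw [hzv]
      exact Projectivization.smul_mk g hv
    · rw [herm_mulVec_mulVec (hG hg)]
      linarith [hF g hg v]
  have hmem : ξ ∈ S := hclosed.closure_subset_iff.mpr hsub
    (mem_closure_iff_clusterPt.mpr hacc.clusterPt)
  obtain ⟨w, hw, hξw, hΨ⟩ := hmem
  obtain ⟨a, ha⟩ := (Projectivization.mk_eq_mk_iff' _ _ _ _ _).mp (hξb.symm.trans hξw)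
  refine ⟨b, hb, hξb, hbb, ?_⟩
  have h1 : F b + c * (herm b b).re ≤ 0 := by
    rw [← ha, ← op_unop a, hh, herm_self_smul]
    have := Quaternion.normSq_nonneg (a := unop a)
    nlinarith
  rw [hbb] at h1
  simpa using h1

theorem norm_mul_norm_eq_one {g : GL (Fin 3) ℍ[ℝ]} (hg : g ∈ Sp21) {e y : Fin 3 → ℍ[ℝ]}
    {h k : ℍ[ℝ]} (he : g.val *ᵥ e = op h • e) (hy : g.val *ᵥ y = op k • y)
    (hye : herm y e ≠ 0) : ‖h‖ * ‖k‖ = 1 := by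
  have h1 := herm_mulVec_mulVec hg y e
  rw [he, hy, herm_smul_left, herm_smul_right] at h1
  have h2 := congrArg norm h1
  rw [norm_mul, norm_mul, norm_star] at h2
  have h3 : ‖herm y e‖ ≠ 0 := norm_ne_zero_iff.mpr hye
  apply mul_right_cancel₀ h3
  linarith

theorem norm_eigenvalue_mul_norm_herm {g : GL (Fin 3) ℍ[ℝ]} (hg : g ∈ Sp21)
    {e : Fin 3 → ℍ[ℝ]} {h : ℍ[ℝ]} (he : g.val *ᵥ e = op h • e) (p : Fin 3 → ℍ[ℝ]) :
    ‖h‖ * ‖herm (g.val *ᵥ p) e‖ = ‖herm p e‖ := by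
  have h1 := herm_mulVec_mulVec hg p e
  rw [he, herm_smul_right] at h1
  rw [← h1, norm_mul, norm_star]

theorem normSq_eq_norm_sq (a : ℍ[ℝ]) : Quaternion.normSq a = ‖a‖ ^ 2 := by
  rw [Quaternion.normSq_eq_norm_mul_self, sq]

theorem limitSet_eq_empty_of_fixed_negative {G : Subgroup (GL (Fin 3) ℍ[ℝ])} (hG : G ≤ Sp21)
    {v : Fin 3 → ℍ[ℝ]} (hv : (herm v v).re < 0)
    (hfix : ∀ g ∈ G, ∃ h : ℍ[ℝ], g.val *ᵥ v = op h • v) : limitSet G = ∅ := by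
  refine Set.eq_empty_of_forall_notMem fun ξ hξ => ?_
  obtain ⟨b, hb, -, hbb, hF⟩ := exists_rep_of_mem_limitSet hG (F := fun p => ‖herm p v‖ ^ 2)
    ((continuous_herm_left v).norm.pow 2)
    (fun h p => by rw [herm_smul_left, norm_mul, normSq_eq_norm_sq]; ring) 1
    (fun g hg p => by
      obtain ⟨h, hh⟩ := hfix g hg
      have h1 := herm_mulVec_mulVec (hG hg) v v
      have h2 : Quaternion.normSq h = 1 := by
        rw [hh] at h1
        have h2 := herm_self_smul h v
        rw [h1] at h2
        exact mul_right_cancel₀ hv.ne (by rw [one_mul, ← h2])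
      have h3 : ‖h‖ = 1 := by
        rw [normSq_eq_norm_sq] at h2
        exact (pow_eq_one_iff_of_nonneg (norm_nonneg h) two_ne_zero).mp h2
      rw [← norm_eigenvalue_mul_norm_herm (hG hg) hh p, h3, one_mul, one_mul]) hξ
  have h0 : herm b v = 0 := norm_eq_zero.mp (pow_eq_zero_iff two_ne_zero |>.mp
    (le_antisymm hF (sq_nonneg _)))
  have := herm_self_pos_of_orthogonal hv hb h0
  rw [hbb] at this
  simp at this

theorem mk_eq_of_null_of_orthogonal {b e : Fin 3 → ℍ[ℝ]} (hb : b ≠ 0) (he : e ≠ 0)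
    (hbb : herm b b = 0) (hee : herm e e = 0) (hbe : herm b e = 0) :
    Projectivization.mk ℍ[ℝ]ᵐᵒᵖ b hb = Projectivization.mk ℍ[ℝ]ᵐᵒᵖ e he := by
  obtain ⟨c, hc⟩ := exists_eq_smul_of_orthogonal he (by simp [hee]) (by simp [hbb]) hbe
  exact mk_eq_mk_of_smul hb he hc

theorem limitSet_subset_of_fixed_horospheres {G : Subgroup (GL (Fin 3) ℍ[ℝ])} (hG : G ≤ Sp21)
    {e : Fin 3 → ℍ[ℝ]} (he : e ≠ 0) (hee : herm e e = 0)
    (hfix : ∀ g ∈ G, ∃ h : ℍ[ℝ], ‖h‖ = 1 ∧ g.val *ᵥ e = op h • e) :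
    limitSet G ⊆ {Projectivization.mk ℍ[ℝ]ᵐᵒᵖ e he} := by
  intro ξ hξ
  obtain ⟨b, hb, rfl, hbb, hF⟩ := exists_rep_of_mem_limitSet hG (F := fun p => ‖herm p e‖ ^ 2)
    ((continuous_herm_left e).norm.pow 2)
    (fun h p => by rw [herm_smul_left, norm_mul, normSq_eq_norm_sq]; ring) 1
    (fun g hg p => by
      obtain ⟨h, h1, hh⟩ := hfix g hg
      rw [← norm_eigenvalue_mul_norm_herm (hG hg) hh p, h1, one_mul, one_mul]) hξ
  exact mk_eq_of_null_of_orthogonal hb he hbb hee (norm_eq_zero.mp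
    (pow_eq_zero_iff two_ne_zero |>.mp (le_antisymm hF (sq_nonneg _))))

/-- The factors by which `g` scales `e` and `y` have reciprocal norms, so `|⟨p, e⟩| |⟨p, y⟩|` is
invariant; a null vector at which it vanishes is proportional to `e` or `y`. -/
theorem limitSet_subset_of_fixed_pair {G : Subgroup (GL (Fin 3) ℍ[ℝ])} (hG : G ≤ Sp21)
    {e y : Fin 3 → ℍ[ℝ]} (he : e ≠ 0) (hy : y ≠ 0) (hee : herm e e = 0) (hyy : herm y y = 0)
    (hye : herm y e ≠ 0) (hfe : ∀ g ∈ G, ∃ h : ℍ[ℝ], g.val *ᵥ e = op h • e)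
    (hfy : ∀ g ∈ G, ∃ h : ℍ[ℝ], g.val *ᵥ y = op h • y) :
    limitSet G ⊆ {Projectivization.mk ℍ[ℝ]ᵐᵒᵖ e he, Projectivization.mk ℍ[ℝ]ᵐᵒᵖ y hy} := by
  intro ξ hξ
  obtain ⟨b, hb, rfl, hbb, hF⟩ := exists_rep_of_mem_limitSet hG
    (F := fun p => ‖herm p e‖ * ‖herm p y‖)
    ((continuous_herm_left e).norm.mul (continuous_herm_left y).norm)
    (fun h p => by
      rw [herm_smul_left, herm_smul_left, norm_mul, norm_mul, normSq_eq_norm_sq]; ring) 1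
    (fun g hg p => by
      obtain ⟨h, hh⟩ := hfe g hg
      obtain ⟨k, hk⟩ := hfy g hg
      rw [← norm_eigenvalue_mul_norm_herm (hG hg) hh p, ← norm_eigenvalue_mul_norm_herm (hG hg) hk p]
      have := norm_mul_norm_eq_one (hG hg) hh hk hye
      apply le_of_eq
      linear_combination (-‖herm (g.val *ᵥ p) e‖ * ‖herm (g.val *ᵥ p) y‖) * this) hξ
  have h0 : ‖herm b e‖ * ‖herm b y‖ = 0 := le_antisymm hF (by positivity)
  rcases mul_eq_zero.mp h0 with h | h
  · exact Or.inl (mk_eq_of_null_of_orthogonal hb he hbb hee (norm_eq_zero.mp h))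
  · exact Or.inr (mk_eq_of_null_of_orthogonal hb hy hbb hyy (norm_eq_zero.mp h))

/-- A group with a uniform bound on its matrix entries has no limit points. -/
theorem limitSet_eq_empty_of_bounded {G : Subgroup (GL (Fin 3) ℍ[ℝ])} (hG : G ≤ Sp21) (K : ℝ)
    (hb : ∀ g ∈ G, ∀ i j, ‖g.val i j‖ ≤ K) : limitSet G = ∅ := by
  have hK : 0 ≤ K := (norm_nonneg _).trans (hb 1 G.one_mem 0 0)
  refine Set.eq_empty_of_forall_notMem fun ξ hξ => ?_
  obtain ⟨b, hb0, -, -, hF⟩ := exists_rep_of_mem_limitSet hG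
    (F := fun p => (‖p 0‖ + ‖p 1‖ + ‖p 2‖) ^ 2) (by fun_prop)
    (fun h p => by
      simp only [Pi.smul_apply, op_smul_eq_mul, norm_mul, normSq_eq_norm_sq]; ring) ((3 * K) ^ 2)
    (fun g hg p => by
      have key : ∀ i, ‖(g.val *ᵥ p) i‖ ≤ K * (‖p 0‖ + ‖p 1‖ + ‖p 2‖) := fun i => by
        have : (g.val *ᵥ p) i = g.val i 0 * p 0 + g.val i 1 * p 1 + g.val i 2 * p 2 := by
          simp [Matrix.mulVec, dotProduct, Fin.sum_univ_three]
        rw [this]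
        refine (norm_add₃_le).trans ?_
        simp only [norm_mul, mul_add]
        gcongr <;> exact hb g hg _ _
      rw [← mul_pow]
      gcongr
      linarith [key 0, key 1, key 2]) hξ
  apply hb0
  have h0 : ‖b 0‖ + ‖b 1‖ + ‖b 2‖ = 0 :=
    pow_eq_zero_iff two_ne_zero |>.mp (le_antisymm hF (sq_nonneg _))
  have n0 := norm_nonneg (b 0)
  have n1 := norm_nonneg (b 1)
  have n2 := norm_nonneg (b 2)
  funext i
  apply norm_eq_zero.mp
  fin_cases i
  · change ‖b 0‖ = 0; linarith
  · change ‖b 1‖ = 0; linarith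
  · change ‖b 2‖ = 0; linarith

/-! ### Discrete groups fixing a boundary point -/

/-- Since `C⁻¹ = J C* J`, the entries of a conjugate are values of the form on the columns of `C`;
the outer `J` reverses the row index, whence `i.rev`. -/
theorem conj_apply {C : GL (Fin 3) ℍ[ℝ]} (hC : C ∈ Sp21) (g : GL (Fin 3) ℍ[ℝ]) (i j : Fin 3) :
    (C⁻¹ * g * C).val i j = herm (g.val *ᵥ C.val.col j) (C.val.col i.rev) := by
  have h1 : (C⁻¹ * g * C).val = formJ ℍ[ℝ] * (C.valᴴ * formJ ℍ[ℝ] * (g.val * C.val)) := by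
    rw [Units.val_mul, Units.val_mul, ← adj_val hC, adj]
    simp only [mul_assoc]
  have h2 : ∀ N : Matrix (Fin 3) (Fin 3) ℍ[ℝ], (formJ ℍ[ℝ] * N) i j = N i.rev j := fun N => by
    fin_cases i <;> simp [formJ, Matrix.mul_apply, Fin.sum_univ_three, Fin.rev]
  have h3 : g.val *ᵥ C.val.col j = (g.val * C.val).col j := by
    ext k : 1
    simp [Matrix.mulVec, dotProduct, Matrix.mul_apply, Matrix.col, Matrix.transpose]
  rw [h1, h2, h3, herm, Matrix.mul_assoc, Matrix.mul_apply, dotProduct]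
  rfl

theorem herm_col {C : GL (Fin 3) ℍ[ℝ]} (hC : C ∈ Sp21) (i j : Fin 3) :
    herm (C.val.col j) (C.val.col i) = formJ ℍ[ℝ] i j := by
  rw [← conjTranspose_formJ_mul_apply, mem_Sp21_iff.mp hC]

theorem exists_herm_eq_one {e : Fin 3 → ℍ[ℝ]} (he : e ≠ 0) : ∃ q, herm q e = 1 := by
  by_contra! h
  apply he
  apply herm_nondegenerate
  intro q
  by_contra hq
  have hq' : herm q e ≠ 0 := fun h0 => hq (herm_eq_zero_comm.mp h0)
  exact h (op (herm q e)⁻¹ • q) (by rw [herm_smul_left, mul_inv_cancel₀ hq'])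

theorem eigenvalue_ne_zero {g : GL (Fin 3) ℍ[ℝ]} {e : Fin 3 → ℍ[ℝ]} (he : e ≠ 0) {h : ℍ[ℝ]}
    (hge : g.val *ᵥ e = op h • e) : h ≠ 0 := by
  rintro rfl
  exact mulVec_ne_zero g he (by rw [hge, op_zero, zero_smul])

theorem inv_mulVec_of_eigen {g : GL (Fin 3) ℍ[ℝ]} {e : Fin 3 → ℍ[ℝ]} (he : e ≠ 0) {h : ℍ[ℝ]}
    (hge : g.val *ᵥ e = op h • e) : (g⁻¹).val *ᵥ e = op h⁻¹ • e := by
  have h0 := eigenvalue_ne_zero he hge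
  have h1 : g.val *ᵥ (op h⁻¹ • e) = e := by
    rw [mulVec_op_smul, hge, smul_smul, ← op_mul, mul_inv_cancel₀ h0, op_one, one_smul]
  conv_lhs => rw [← h1]
  exact inv_mulVec_mulVec g _

theorem eq_of_op_smul_eq {e : Fin 3 → ℍ[ℝ]} (he : e ≠ 0) {a b : ℍ[ℝ]}
    (hab : op a • e = op b • e) : a = b :=
  op_injective (smul_left_injective _ he hab)

/-- A loxodromic isometry has a second fixed point at infinity. -/
theorem exists_second_fixed_point {g : GL (Fin 3) ℍ[ℝ]} (hg : g ∈ Sp21) {e : Fin 3 → ℍ[ℝ]}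
    (he : e ≠ 0) (hee : herm e e = 0) {h : ℍ[ℝ]} (hge : g.val *ᵥ e = op h • e) (hh : 1 < ‖h‖) :
    ∃ (y : Fin 3 → ℍ[ℝ]) (k : ℍ[ℝ]), g.val *ᵥ y = op k • y ∧ herm y y = 0 ∧ herm y e ≠ 0 := by
  have h0 := eigenvalue_ne_zero he hge
  set k := (star h)⁻¹ with hk
  have hkn : ‖k‖ < 1 := by rw [hk, norm_inv, norm_star]; exact inv_lt_one_of_one_lt₀ hh
  let L : (Fin 3 → ℍ[ℝ]) →ₗ[ℝ] (Fin 3 → ℍ[ℝ]) :=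
    { toFun := fun p => g.val *ᵥ p - op k • p
      map_add' := fun p q => by rw [Matrix.mulVec_add, smul_add]; abel
      map_smul' := fun t p => by
        rw [Matrix.mulVec_smul, smul_comm (op k), smul_sub, RingHom.id_apply] }
  -- Pairing `L p` with `e` gives a commutator, whose real part is zero. Hence `L` misses vectors
  -- pairing to `1`, and being a real endomorphism of finite dimension it has a kernel.
  have hL : ∀ p, herm (L p) e = k * herm p e - herm p e * k := fun p => by
    have h1 : herm (g.val *ᵥ p) e = k * herm p e := by
      rw [← herm_mulVec_mulVec hg p e, hge, herm_smul_right, ← mul_assoc, hk,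
        inv_mul_cancel₀ (star_ne_zero.mpr h0), one_mul]
    change herm (g.val *ᵥ p - op k • p) e = _
    rw [sub_eq_add_neg, herm_add_left, herm_neg_left, herm_smul_left, h1, ← sub_eq_add_neg]
  have hns : ¬ Function.Surjective L := fun hs => by
    obtain ⟨q, hq⟩ := exists_herm_eq_one he
    obtain ⟨p, rfl⟩ := hs q
    rw [hL] at hq
    have := congrArg (fun a : ℍ[ℝ] => a.re) hq
    simp only [Quaternion.re_sub, Quaternion.re_mul, Quaternion.re_one] at this
    linarith
  have hni : ¬ Function.Injective L := fun hi => hns (LinearMap.injective_iff_surjective.mp hi)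
  rw [← LinearMap.ker_eq_bot] at hni
  obtain ⟨y, hy, hy0⟩ := Submodule.exists_mem_ne_zero_of_ne_bot hni
  have hgy : g.val *ᵥ y = op k • y := sub_eq_zero.mp (LinearMap.mem_ker.mp hy)
  have hyy : herm y y = 0 := by
    have h1 := herm_self_smul k y
    rw [← hgy, herm_mulVec_mulVec hg, normSq_eq_norm_sq] at h1
    have h2 : (1 - ‖k‖ ^ 2) * (herm y y).re = 0 := by linarith
    rcases mul_eq_zero.mp h2 with h3 | h3
    · nlinarith [norm_nonneg k]
    · rw [herm_self_eq_coe, h3, Quaternion.coe_zero]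
  -- A null `y` orthogonal to `e` would be a multiple of `e`, making `h` and `k` conjugate; but `‖k‖
  -- < 1 < ‖h‖`.
  refine ⟨y, k, hgy, hyy, fun hye => ?_⟩
  obtain ⟨c, rfl⟩ := exists_eq_smul_of_orthogonal he (by simp [hee]) (by simp [hyy]) hye
  have hc : c ≠ 0 := by rintro rfl; simp at hy0
  rw [mulVec_op_smul, hge, smul_smul, smul_smul, ← op_mul, ← op_mul] at hgy
  have h1 := congrArg norm (eq_of_op_smul_eq he hgy)
  rw [norm_mul, norm_mul, mul_comm] at h1
  have h2 := mul_left_cancel₀ (norm_ne_zero_iff.mpr hc) h1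
  linarith

theorem continuous_adj : Continuous adj :=
  (continuous_const.matrix_mul continuous_id.matrix_conjTranspose).matrix_mul continuous_const

/-- The topology on units also controls inverses; in `Sp(2,1)` the inverse is the adjoint, which is
continuous, so compactness in the matrices alone suffices. -/
theorem finite_of_isCompact {G : Subgroup (GL (Fin 3) ℍ[ℝ])} (hG : IsKleinian G)
    {S : Set (Matrix (Fin 3) (Fin 3) ℍ[ℝ])} (hS : IsCompact S) :
    {g : GL (Fin 3) ℍ[ℝ] | g ∈ G ∧ g.val ∈ S}.Finite := by
  have := hG.2
  have hcl : IsClosed (G : Set (GL (Fin 3) ℍ[ℝ])) := Subgroup.isClosed_of_discrete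
  have hK := Units.isClosedEmbedding_embedProduct.isCompact_preimage
      (hS.prod ((hS.image continuous_adj).image continuous_op))
  have hfin := isCompact_iff_finite.mp (hcl.isClosedEmbedding_subtypeVal.isCompact_preimage hK)
  refine (hfin.image Subtype.val).subset ?_
  rintro g ⟨hg, hgS⟩
  have h1 : (g⁻¹).val ∈ adj '' S := ⟨g.val, hgS, adj_val (hG.1 hg)⟩
  exact ⟨⟨g, hg⟩, ⟨hgS, Set.mem_image_of_mem op h1⟩, rfl⟩

theorem isCompact_setOf_entries_le (K : ℝ) :
    IsCompact {m : Matrix (Fin 3) (Fin 3) ℍ[ℝ] | ∀ i j, ‖m i j‖ ≤ K} := by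
  have h : IsCompact (Set.pi Set.univ fun _ : Fin 3 => Set.pi Set.univ fun _ : Fin 3 =>
      Metric.closedBall (0 : ℍ[ℝ]) K) :=
    isCompact_univ_pi fun _ => isCompact_univ_pi fun _ => isCompact_closedBall _ _
  have heq : {m : Matrix (Fin 3) (Fin 3) ℍ[ℝ] | ∀ i j, ‖m i j‖ ≤ K} =
      Set.pi Set.univ fun _ : Fin 3 => Set.pi Set.univ fun _ : Fin 3 =>
      Metric.closedBall (0 : ℍ[ℝ]) K := by
    ext m
    refine forall_congr' fun i => ⟨fun hm _ j _ => ?_, fun hm j => ?_⟩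
    · exact mem_closedBall_zero_iff.mpr (hm j)
    · exact mem_closedBall_zero_iff.mp (hm trivial j trivial)
  rw [heq]
  exact h

theorem eq_zero_of_finite_geometric {r : ℝ} (hr0 : 0 < r) (hr1 : r < 1) {a : ℝ}
    (hf : (Set.range fun n : ℕ => r ^ n * a).Finite) : a = 0 := by
  by_contra ha
  refine Set.infinite_range_of_injective (fun m n hmn => ?_) hf
  exact pow_right_injective₀ hr0 hr1.ne (mul_right_cancel₀ ha hmn)

/-- A loxodromic element of a discrete group shares either none or both of its fixed points
with the other elements. -/
theorem fixes_second_point {G : Subgroup (GL (Fin 3) ℍ[ℝ])} (hG : IsKleinian G)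
    {e y : Fin 3 → ℍ[ℝ]} (hee : herm e e = 0) (hyy : herm y y = 0) (hye : herm y e = 1)
    {g₀ : GL (Fin 3) ℍ[ℝ]} (hg₀ : g₀ ∈ G) {h k : ℍ[ℝ]} (hh : 1 < ‖h‖)
    (he₀ : g₀.val *ᵥ e = op h • e) (hy₀ : g₀.val *ᵥ y = op k • y)
    {g : GL (Fin 3) ℍ[ℝ]} (hg : g ∈ G) {a : ℍ[ℝ]} (hge : g.val *ᵥ e = op a • e) :
    ∃ l : ℍ[ℝ], g.val *ᵥ y = op l • y := by
  obtain ⟨C, hC, rfl, rfl⟩ := exists_mem_Sp21_of_null_pair hee hyy hye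
  have hhk := norm_mul_norm_eq_one (hG.1 hg₀) he₀ hy₀ (by rw [hye]; exact one_ne_zero)
  have hk0 : k ≠ 0 := by rintro rfl; simp at hhk
  have hh0 : h ≠ 0 := by rintro rfl; simp at hhk
  have hcol := herm_col hC
  set e := C.val.col 0
  set y := C.val.col 2
  set f := C.val.col 1
  have orth : ∀ {g : GL (Fin 3) ℍ[ℝ]} {e' : Fin 3 → ℍ[ℝ]} {b : ℍ[ℝ]}, g ∈ G → b ≠ 0 →
      g.val *ᵥ e' = op b • e' → ∀ p, herm p e' = 0 → herm (g.val *ᵥ p) e' = 0 := by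
    intro g e' b hg hb hge p hp
    have h1 := norm_eigenvalue_mul_norm_herm (hG.1 hg) hge p
    rw [hp, norm_zero] at h1
    exact norm_eq_zero.mp ((mul_eq_zero.mp h1).resolve_left (norm_ne_zero_iff.mpr hb))
  have hfe : herm f e = 0 := by rw [hcol]; rfl
  have hfy : herm f y = 0 := by rw [hcol]; rfl
  have hey : herm e y = 1 := by rw [hcol]; rfl
  have hef : herm e f = 0 := by rw [hcol]; rfl
  have hyf : herm y f = 0 := by rw [hcol]; rfl
  have ha0 : a ≠ 0 := by
    rintro rfl
    refine mulVec_ne_zero g (p := e) (fun h0 => ?_) (by rw [hge, op_zero, zero_smul])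
    rw [h0, herm_zero_right] at hye
    exact zero_ne_one hye
  set D := C⁻¹ * g₀ * C with hD
  set m := C⁻¹ * g * C with hm
  set d : Fin 3 → ℍ[ℝ] := ![h, D.val 1 1, k] with hd
  have hDd : D.val = Matrix.diagonal d := by
    ext i j : 1
    fin_cases i <;> fin_cases j <;>
      simp [hd, -Units.val_mul]
    all_goals
      simp only [hD, conj_apply hC]
    · change herm (g₀.val *ᵥ e) y = h
      rw [he₀, herm_smul_left, hey, one_mul]
    · exact orth hg₀ hk0 hy₀ f hfy
    · change herm (g₀.val *ᵥ y) y = 0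
      rw [hy₀, herm_smul_left, hyy, zero_mul]
    · change herm (g₀.val *ᵥ e) f = 0
      rw [he₀, herm_smul_left, hef, zero_mul]
    · change herm (g₀.val *ᵥ y) f = 0
      rw [hy₀, herm_smul_left, hyf, zero_mul]
    · change herm (g₀.val *ᵥ e) e = 0
      rw [he₀, herm_smul_left, hee, zero_mul]
    · exact orth hg₀ hh0 he₀ f hfe
    · change herm (g₀.val *ᵥ y) e = k
      rw [hy₀, herm_smul_left, hye, one_mul]
  have hDS : D ∈ Sp21 := Sp21.mul_mem (Sp21.mul_mem (Sp21.inv_mem hC) (hG.1 hg₀)) hC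
  have hd1 : ‖d 1‖ = 1 := by
    have h1 := herm_col hDS 1 1
    have h2 : D.val.col 1 = ![0, d 1, 0] := by
      rw [hDd]
      funext i
      fin_cases i <;> simp [Matrix.col]
    rw [h2, herm_eq] at h1
    simp [formJ] at h1
    have h3 := congrArg norm h1
    rw [norm_mul, norm_star, norm_one] at h3
    exact (mul_self_eq_one_iff.mp h3).resolve_right (by linarith [norm_nonneg (d 1)])
  have hd0 : ∀ i, d i ≠ 0 := by
    intro i
    fin_cases i
    · exact hh0
    · exact norm_ne_zero_iff.mp (by change ‖d 1‖ ≠ 0; rw [hd1]; exact one_ne_zero)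
    · exact hk0
  have hDinv : (D⁻¹).val = Matrix.diagonal fun i => (d i)⁻¹ := by
    refine left_inv_eq_right_inv (a := D.val) D.inv_mul ?_
    rw [hDd, Matrix.diagonal_mul_diagonal]
    simp [hd0]
  -- In the frame `C`, `g₀` is diagonal and `g` is upper triangular. Conjugating by powers of `g₀`
  -- contracts the entries above the diagonal, so these conjugates stay bounded, and by discreteness
  -- only finitely many are distinct. The contracted entries `(1, 2)` and `(0, 2)` must then be
  -- zero.
  have hpow : ∀ (n : ℕ) i j, (C⁻¹ * ((g₀⁻¹) ^ n * g * g₀ ^ n) * C).val i j =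
      (d i)⁻¹ ^ n * m.val i j * d j ^ n := fun n i j => by
    have h1 : C⁻¹ * ((g₀⁻¹) ^ n * g * g₀ ^ n) * C = (D⁻¹) ^ n * m * D ^ n := by
      have h2 : D ^ n = C⁻¹ * g₀ ^ n * C := by
        have := conj_pow (i := n) (a := C⁻¹) (b := g₀)
        rwa [inv_inv] at this
      rw [inv_pow D, h2, hm]
      group
    rw [h1, Units.val_mul, Units.val_mul, Units.val_pow_eq_pow_val, Units.val_pow_eq_pow_val, hDd,
      hDinv, Matrix.diagonal_pow, Matrix.diagonal_pow, Matrix.mul_diagonal, Matrix.diagonal_mul]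
    rfl
  have hm10 : m.val 1 0 = 0 := by
    rw [hm, conj_apply hC]
    change herm (g.val *ᵥ e) f = 0
    rw [hge, herm_smul_left, hef, zero_mul]
  have hm20 : m.val 2 0 = 0 := by
    rw [hm, conj_apply hC]
    change herm (g.val *ᵥ e) e = 0
    rw [hge, herm_smul_left, hee, zero_mul]
  have hm21 : m.val 2 1 = 0 := by
    rw [hm, conj_apply hC]
    exact orth hg ha0 hge f hfe
  have hkn : ‖k‖ = ‖h‖⁻¹ := eq_inv_of_mul_eq_one_right hhk
  have hk1 : ‖k‖ < 1 := by rw [hkn]; exact inv_lt_one_of_one_lt₀ hh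
  have hkpos : 0 < ‖k‖ := norm_pos_iff.mpr hk0
  have hnorm : ∀ (n : ℕ) i j, ‖(C⁻¹ * ((g₀⁻¹) ^ n * g * g₀ ^ n) * C).val i j‖ =
      (‖d i‖⁻¹ * ‖d j‖) ^ n * ‖m.val i j‖ := fun n i j => by
    rw [hpow, norm_mul, norm_mul, norm_pow, norm_pow, norm_inv, mul_pow]; ring
  have hn0 : ‖d 0‖⁻¹ = ‖k‖ := hkn.symm
  have hn2 : ‖d 2‖ = ‖k‖ := rfl
  obtain ⟨K, hK⟩ : ∃ K : ℝ, ∀ i j, ‖m.val i j‖ ≤ K := by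
    refine ⟨∑ i, ∑ j, ‖m.val i j‖, fun i j => ?_⟩
    exact (Finset.single_le_sum (f := fun j => ‖m.val i j‖) (fun _ _ => norm_nonneg _)
      (Finset.mem_univ j)).trans
      (Finset.single_le_sum (f := fun i => ∑ j, ‖m.val i j‖)
        (fun _ _ => Finset.sum_nonneg fun _ _ => norm_nonneg _) (Finset.mem_univ i))
  have hbound : ∀ (n : ℕ) i j, ‖(C⁻¹ * ((g₀⁻¹) ^ n * g * g₀ ^ n) * C).val i j‖ ≤ K := by
    intro n i j
    rw [hnorm]
    have key : m.val i j = 0 ∨ ‖d i‖⁻¹ * ‖d j‖ ≤ 1 := by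
      fin_cases i <;> fin_cases j
      · right; exact (inv_mul_cancel₀ (norm_ne_zero_iff.mpr (hd0 0))).le
      · right; change ‖d 0‖⁻¹ * ‖d 1‖ ≤ 1; rw [hn0, hd1]; linarith
      · right; change ‖d 0‖⁻¹ * ‖d 2‖ ≤ 1; rw [hn0, hn2]; nlinarith
      · left; exact hm10
      · right; exact (inv_mul_cancel₀ (norm_ne_zero_iff.mpr (hd0 1))).le
      · right; change ‖d 1‖⁻¹ * ‖d 2‖ ≤ 1; rw [hd1, hn2]; linarith
      · left; exact hm20
      · left; exact hm21
      · right; exact (inv_mul_cancel₀ (norm_ne_zero_iff.mpr (hd0 2))).le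
    rcases key with h0 | h1
    · rw [h0, norm_zero, mul_zero]; exact (norm_nonneg _).trans (hK 0 0)
    · calc _ ≤ 1 * ‖m.val i j‖ := by
            gcongr
            exact pow_le_one₀ (by positivity) h1
        _ ≤ K := by rw [one_mul]; exact hK i j
  have hfin := finite_of_isCompact hG ((isCompact_setOf_entries_le K).image
    (f := fun N => C.val * N * (C⁻¹).val)
    ((continuous_const.matrix_mul continuous_id).matrix_mul continuous_const))
  have hseq : ∀ n : ℕ, (g₀⁻¹) ^ n * g * g₀ ^ n ∈ {g : GL (Fin 3) ℍ[ℝ] | g ∈ G ∧ g.val ∈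
      (fun N => C.val * N * (C⁻¹).val) '' {m | ∀ i j, ‖m i j‖ ≤ K}} := fun n => by
    refine ⟨G.mul_mem (G.mul_mem (G.pow_mem (G.inv_mem hg₀) n) hg) (G.pow_mem hg₀ n), _,
      hbound n, ?_⟩
    dsimp only
    rw [← Units.val_mul, ← Units.val_mul]
    congr 1
    group
  have hent : ∀ i j, (Set.range fun n : ℕ => (‖d i‖⁻¹ * ‖d j‖) ^ n * ‖m.val i j‖).Finite := by
    intro i j
    refine (hfin.image fun g => ‖(C⁻¹ * g * C).val i j‖).subset ?_
    rintro _ ⟨n, rfl⟩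
    exact ⟨_, hseq n, hnorm n i j⟩
  have hm12 : m.val 1 2 = 0 := by
    have := hent 1 2
    rw [hd1, hn2, inv_one, one_mul] at this
    exact norm_eq_zero.mp (eq_zero_of_finite_geometric hkpos hk1 this)
  have hm02 : m.val 0 2 = 0 := by
    have := hent 0 2
    rw [hn0, hn2] at this
    exact norm_eq_zero.mp (eq_zero_of_finite_geometric (by positivity) (by nlinarith) this)
  refine ⟨m.val 2 2, ?_⟩
  have hgC : g.val * C.val = C.val * m.val := by
    rw [← Units.val_mul, ← Units.val_mul, hm]
    congr 1
    group
  funext i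
  have h1 := congrFun (congrFun hgC i) 2
  rw [Matrix.mul_apply, Matrix.mul_apply, Fin.sum_univ_three, Fin.sum_univ_three, hm02, hm12,
    mul_zero, mul_zero, zero_add, zero_add] at h1
  rw [Pi.smul_apply, op_smul_eq_mul, Matrix.mulVec, dotProduct, Fin.sum_univ_three]
  exact h1

/-- If no element expands `e`, applying this to inverses shows that all eigenvalues on `e` have norm
one. -/
theorem isElementary_of_fixed_null {G : Subgroup (GL (Fin 3) ℍ[ℝ])} (hG : IsKleinian G)
    {e : Fin 3 → ℍ[ℝ]} (he : e ≠ 0) (hee : herm e e = 0)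
    (hfix : ∀ g ∈ G, ∃ h : ℍ[ℝ], g.val *ᵥ e = op h • e) : IsElementary G := by
  by_cases hlox : ∃ g ∈ G, ∃ h : ℍ[ℝ], g.val *ᵥ e = op h • e ∧ 1 < ‖h‖
  · obtain ⟨g₀, hg₀, h, hge, hh⟩ := hlox
    obtain ⟨y, k, hgy, hyy, hye⟩ := exists_second_fixed_point (hG.1 hg₀) he hee hge hh
    set c := (herm y e)⁻¹ with hc
    have hc0 : c ≠ 0 := inv_ne_zero hye
    have hye' : herm (op c • y) e = 1 := by rw [herm_smul_left, hc, mul_inv_cancel₀ hye]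
    have hyy' : herm (op c • y) (op c • y) = 0 := by
      rw [herm_smul_left, herm_smul_right, hyy, mul_zero, zero_mul]
    have hgy' : g₀.val *ᵥ (op c • y) = op (c⁻¹ * k * c) • (op c • y) := by
      rw [mulVec_op_smul, hgy, smul_smul, smul_smul, ← op_mul, ← op_mul, ← mul_assoc, ← mul_assoc,
        mul_inv_cancel₀ hc0, one_mul]
    have hy0 : op c • y ≠ 0 := by
      intro h0
      rw [h0, herm_zero_left] at hye'
      exact zero_ne_one hye'
    refine (Set.encard_le_encard (limitSet_subset_of_fixed_pair hG.1 he hy0 hee hyy'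
      (by rw [hye']; exact one_ne_zero) hfix fun g hg => ?_)).trans
      ((Set.encard_insert_le _ _).trans (by rw [Set.encard_singleton]; norm_num))
    obtain ⟨a, ha⟩ := hfix g hg
    exact fixes_second_point hG hee hyy' hye' hg₀ hh hge hgy' hg ha
  · push Not at hlox
    refine (Set.encard_le_encard (limitSet_subset_of_fixed_horospheres hG.1 he hee
      fun g hg => ?_)).trans (by rw [Set.encard_singleton]; exact one_le_two)
    obtain ⟨h, hh⟩ := hfix g hg
    refine ⟨h, le_antisymm (hlox g hg h hh) ?_, hh⟩
    have h1 := hlox g⁻¹ (G.inv_mem hg) h⁻¹ (inv_mulVec_of_eigen he hh)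
    rw [norm_inv] at h1
    exact (inv_le_one₀ (norm_pos_iff.mpr (eigenvalue_ne_zero he hh))).mp h1

/-! ### Invariant submanifolds -/

theorem smul_mem_hypPlane {g : GL (Fin 3) ℍ[ℝ]} (hg : g ∈ Sp21) {x : HP2} (hx : x ∈ hypPlane) :
    g • x ∈ hypPlane := by
  obtain ⟨v, hv, rfl, hneg⟩ := hx
  exact ⟨g.val *ᵥ v, mulVec_ne_zero g hv, Projectivization.smul_mk g hv,
    by rwa [herm_mulVec_mulVec hg]⟩

theorem leavesInvariant_of_conj {G : Subgroup (GL (Fin 3) ℍ[ℝ])} {C : GL (Fin 3) ℍ[ℝ]}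
    {L : Set HP2} (h : ∀ g ∈ G, ∀ x ∈ L, (C⁻¹ * g * C) • x ∈ L) : LeavesInvariant G (C • L) := by
  have key : ∀ g ∈ G, g • C • L ⊆ C • L := by
    rintro g hg _ ⟨_, ⟨x, hx, rfl⟩, rfl⟩
    refine ⟨(C⁻¹ * g * C) • x, h g hg x hx, ?_⟩
    change C • (C⁻¹ * g * C) • x = g • C • x
    rw [smul_smul, smul_smul]
    congr 1
    group
  intro g hg
  exact (key g hg).antisymm fun x hx =>
    ⟨g⁻¹ • x, key g⁻¹ (G.inv_mem hg) ⟨x, hx, rfl⟩, smul_inv_smul g x⟩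

theorem conj_mem_Sp21 {g C : GL (Fin 3) ℍ[ℝ]} (hg : g ∈ Sp21) (hC : C ∈ Sp21) :
    C⁻¹ * g * C ∈ Sp21 := Sp21.mul_mem (Sp21.mul_mem (Sp21.inv_mem hC) hg) hC

theorem IsBlock.smul_mem {m : GL (Fin 3) ℍ[ℝ]} (hm : IsBlock m) (hmS : m ∈ Sp21) {x : HP2}
    (hx : x ∈ stdQuaternionicLine) : m • x ∈ stdQuaternionicLine := by
  obtain ⟨hx, v, hv, rfl, hv1⟩ := hx
  refine ⟨smul_mem_hypPlane hmS hx, m.val *ᵥ v, mulVec_ne_zero m hv,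
    Projectivization.smul_mk m hv, ?_⟩
  rw [Matrix.mulVec, dotProduct, Fin.sum_univ_three, hm.2.1, hm.2.2.1, hv1, zero_mul, mul_zero,
    zero_mul, add_zero, add_zero]

/-- A group fixing a positive line preserves the polar quaternionic line. -/
theorem exists_block_of_fixed_pos {G : Subgroup (GL (Fin 3) ℍ[ℝ])} (hG : G ≤ Sp21)
    {v : Fin 3 → ℍ[ℝ]} (hv : 0 < (herm v v).re)
    (hfix : ∀ g ∈ G, ∃ h : ℍ[ℝ], g.val *ᵥ v = op h • v) :
    ∃ C ∈ Sp21, LeavesInvariant G (C • stdQuaternionicLine) ∧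
      ∀ g ∈ G, IsBlock (C⁻¹ * g * C) := by
  obtain ⟨C, hC, t, hCt⟩ := exists_mem_Sp21_of_pos hv
  have hblock : ∀ g ∈ G, IsBlock (C⁻¹ * g * C) := by
    intro g hg
    obtain ⟨h, hh⟩ := hfix g hg
    have hgc : g.val *ᵥ C.val.col 1 = op h • C.val.col 1 := by
      rw [hCt, Matrix.mulVec_smul, hh, smul_comm]
    have hcol := herm_col hC
    have hc0 : C.val.col 1 ≠ 0 := fun h0 => by
      have := hcol 1 1
      rw [h0, herm_zero_left] at this
      exact zero_ne_one this
    have hh0 := eigenvalue_ne_zero hc0 hgc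
    have orth : ∀ p, herm p (C.val.col 1) = 0 → herm (g.val *ᵥ p) (C.val.col 1) = 0 := by
      intro p hp
      have h1 := norm_eigenvalue_mul_norm_herm (hG hg) hgc p
      rw [hp, norm_zero] at h1
      exact norm_eq_zero.mp ((mul_eq_zero.mp h1).resolve_left (norm_ne_zero_iff.mpr hh0))
    refine ⟨?_, ?_, ?_, ?_⟩ <;> rw [conj_apply hC]
    · rw [hgc, herm_smul_left, hcol]; exact zero_mul h
    · exact orth _ (by rw [hcol]; rfl)
    · exact orth _ (by rw [hcol]; rfl)
    · rw [hgc, herm_smul_left, hcol]; exact zero_mul h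
  exact ⟨C, hC, leavesInvariant_of_conj fun g hg x hx =>
    (hblock g hg).smul_mem (conj_mem_Sp21 (hG hg) hC) hx, hblock⟩

theorem map_coe_mul (M N : Matrix (Fin 3) (Fin 3) ℝ) :
    (M * N).map (fun r : ℝ => (r : ℍ[ℝ])) =
      M.map (fun r : ℝ => (r : ℍ[ℝ])) * N.map (fun r : ℝ => (r : ℍ[ℝ])) :=
  Matrix.map_mul (f := algebraMap ℝ ℍ[ℝ])

theorem inSO21_of_real {m : GL (Fin 3) ℍ[ℝ]} (hm : m ∈ Sp21)
    {M : Matrix (Fin 3) (Fin 3) ℝ} (hM : m.val = M.map (fun r : ℝ => (r : ℍ[ℝ]))) :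
    InSO21 m := by
  have hJ : (formJ ℝ).map (fun r : ℝ => (r : ℍ[ℝ])) = formJ ℍ[ℝ] := by
    ext i j : 1
    fin_cases i <;> fin_cases j <;> simp [formJ]
  have hT : m.valᴴ = Mᵀ.map (fun r : ℝ => (r : ℍ[ℝ])) := by
    ext i j : 1
    rw [hM, Matrix.conjTranspose_apply, Matrix.map_apply, Matrix.map_apply, Quaternion.star_coe,
      Matrix.transpose_apply]
  have hform : Mᵀ * formJ ℝ * M = formJ ℝ := by
    have h1 := mem_Sp21_iff.mp hm
    rw [hT, hM, ← hJ, ← map_coe_mul, ← map_coe_mul] at h1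
    exact Matrix.map_injective Quaternion.coe_injective h1
  have hdet : M.det * M.det = 1 := by
    have h1 := congrArg Matrix.det hform
    rw [Matrix.det_mul, Matrix.det_mul, Matrix.det_transpose] at h1
    have h2 : (formJ ℝ).det = -1 := by simp [formJ, Matrix.det_fin_three]
    rw [h2] at h1
    linarith
  rcases mul_self_eq_one_iff.mp hdet with h1 | h1
  · exact ⟨M, ⟨hform, h1⟩, Or.inl hM⟩
  -- In odd size, changing the sign of `M` changes the sign of its determinant.
  · refine ⟨-M, ⟨by simpa using hform, ?_⟩, Or.inr ?_⟩
    · rw [Matrix.det_neg, h1]; norm_num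
    · rw [hM]
      ext i j : 1
      simp

theorem real_smul_mem {m : GL (Fin 3) ℍ[ℝ]} (hm : m ∈ Sp21)
    {M : Matrix (Fin 3) (Fin 3) ℝ} (hM : m.val = M.map (fun r : ℝ => (r : ℍ[ℝ])))
    {x : HP2} (hx : x ∈ stdRealPlane) : m • x ∈ stdRealPlane := by
  obtain ⟨hx, w, hw, rfl⟩ := hx
  have h1 : m.val *ᵥ (fun i => (w i : ℍ[ℝ])) = fun i => ((M *ᵥ w) i : ℍ[ℝ]) := by
    funext i
    simp [hM, Matrix.mulVec, dotProduct, Fin.sum_univ_three]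
  have h2 := mulVec_ne_zero m hw
  refine ⟨smul_mem_hypPlane hm hx, M *ᵥ w, h1 ▸ h2, ?_⟩
  rw [Projectivization.smul_mk]
  congr 1

/-- A group with real matrices in some frame preserves the corresponding real plane. -/
theorem exists_SO21_of_real {G : Subgroup (GL (Fin 3) ℍ[ℝ])} (hG : G ≤ Sp21)
    {C : GL (Fin 3) ℍ[ℝ]} (hC : C ∈ Sp21)
    (hreal : ∀ g ∈ G, ∀ i j, ∃ r : ℝ, (C⁻¹ * g * C).val i j = r) :
    LeavesInvariant G (C • stdRealPlane) ∧ ∀ g ∈ G, InSO21 (C⁻¹ * g * C) := by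
  have key : ∀ g ∈ G, ∃ M : Matrix (Fin 3) (Fin 3) ℝ,
      (C⁻¹ * g * C).val = M.map (fun r : ℝ => (r : ℍ[ℝ])) := fun g hg => by
    choose M hM using hreal g hg
    exact ⟨Matrix.of M, by ext i j : 1; exact hM i j⟩
  refine ⟨leavesInvariant_of_conj fun g hg x hx => ?_, fun g hg => ?_⟩
  · obtain ⟨M, hM⟩ := key g hg
    exact real_smul_mem (conj_mem_Sp21 (hG hg) hC) hM hx
  · obtain ⟨M, hM⟩ := key g hg
    exact inSO21_of_real (conj_mem_Sp21 (hG hg) hC) hM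

/-! ### Irreducible groups -/

theorem finrank_quaternion_op : Module.finrank ℍ[ℝ]ᵐᵒᵖ (Fin 3 → ℍ[ℝ]) = 3 := by
  have h1 : Module.finrank ℍ[ℝ]ᵐᵒᵖ ℍ[ℝ] = 1 :=
    finrank_eq_one (1 : ℍ[ℝ]) one_ne_zero fun w => ⟨op w, by rw [op_smul_eq_mul, one_mul]⟩
  have : Module.Finite ℍ[ℝ]ᵐᵒᵖ ℍ[ℝ] := Module.finite_of_finrank_eq_succ h1
  rw [Module.finrank_pi_fintype, Finset.sum_const, h1]
  rfl

instance instFiniteQuaternionOp : Module.Finite ℍ[ℝ]ᵐᵒᵖ (Fin 3 → ℍ[ℝ]) :=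
  Module.finite_of_finrank_eq_succ finrank_quaternion_op

theorem eq_sum_smul_single (x : Fin 3 → ℍ[ℝ]) : x = ∑ i, op (x i) • Pi.single i 1 := by
  funext j
  rw [Finset.sum_apply]
  simp [Pi.single_apply]

theorem exists_herm_eq_functional (f : (Fin 3 → ℍ[ℝ]) →ₗ[ℍ[ℝ]ᵐᵒᵖ] ℍ[ℝ]ᵐᵒᵖ) :
    ∃ v, ∀ x, herm x v = unop (f x) := by
  refine ⟨fun i => star (unop (f (Pi.single i.rev 1))), fun x => ?_⟩
  conv_rhs => rw [eq_sum_smul_single x]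
  simp only [Fin.sum_univ_three, map_add, map_smul, herm_eq, star_star, smul_eq_mul, unop_add,
    unop_mul, unop_op]
  simp only [Fin.rev, Fin.isValue]
  change _ = unop (f (Pi.single 0 1)) * x 0 + unop (f (Pi.single 1 1)) * x 1 +
    unop (f (Pi.single 2 1)) * x 2
  change unop (f (Pi.single 2 1)) * x 2 + unop (f (Pi.single 1 1)) * x 1 +
    unop (f (Pi.single 0 1)) * x 0 = _
  abel

theorem eq_of_herm_right {v w : Fin 3 → ℍ[ℝ]} (h : ∀ x, herm x v = herm x w) : v = w := by
  rw [← sub_eq_zero]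
  refine herm_nondegenerate fun x => herm_eq_zero_comm.mp ?_
  rw [sub_eq_add_neg, herm_add_right, herm_neg_right, h, add_neg_cancel]

/-- If no line is invariant, then orbits of nonzero vectors span. -/
theorem span_orbit_eq_top {G : Subgroup (GL (Fin 3) ℍ[ℝ])} (hG : G ≤ Sp21)
    (hirr : ∀ v : Fin 3 → ℍ[ℝ], v ≠ 0 → ¬ ∀ g ∈ G, ∃ h : ℍ[ℝ], g.val *ᵥ v = op h • v)
    {u : Fin 3 → ℍ[ℝ]} (hu : u ≠ 0) :
    Submodule.span ℍ[ℝ]ᵐᵒᵖ {x | ∃ g ∈ G, x = g.val *ᵥ u} = ⊤ := by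
  by_contra hne
  set N := Submodule.span ℍ[ℝ]ᵐᵒᵖ {x | ∃ g ∈ G, x = g.val *ᵥ u} with hN
  have hmem : ∀ g ∈ G, g.val *ᵥ u ∈ N := fun g hg => Submodule.subset_span ⟨g, hg, rfl⟩
  have huN : u ∈ N := by simpa using hmem 1 G.one_mem
  have hinv : ∀ g ∈ G, ∀ x ∈ N, g.val *ᵥ x ∈ N := by
    intro g hg x hx
    induction hx using Submodule.span_induction with
    | mem x hx =>
      obtain ⟨k, hk, rfl⟩ := hx
      rw [Matrix.mulVec_mulVec, ← Units.val_mul]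
      exact hmem _ (G.mul_mem hg hk)
    | zero => rw [Matrix.mulVec_zero]; exact N.zero_mem
    | add x y _ _ hx hy => rw [Matrix.mulVec_add]; exact N.add_mem hx hy
    | smul a x _ hx => rw [Matrix.mulVec_smul]; exact N.smul_mem a hx
  have hlt : Module.finrank ℍ[ℝ]ᵐᵒᵖ N < 3 := by
    exact (Submodule.finrank_lt hne).trans_eq finrank_quaternion_op
  have hpos : Module.finrank ℍ[ℝ]ᵐᵒᵖ N ≠ 0 := fun h0 => by
    rw [Submodule.finrank_eq_zero] at h0
    rw [h0] at huN
    exact hu ((Submodule.mem_bot _).mp huN)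
  obtain h1 | h2 : Module.finrank ℍ[ℝ]ᵐᵒᵖ N = 1 ∨ Module.finrank ℍ[ℝ]ᵐᵒᵖ N = 2 := by omega
  · refine hirr u hu fun g hg => ?_
    have hu' : (⟨u, huN⟩ : N) ≠ 0 := fun h => hu (congrArg Subtype.val h)
    obtain ⟨c, hc⟩ := (finrank_eq_one_iff_of_nonzero' _ hu').mp h1 ⟨_, hmem g hg⟩
    exact ⟨unop c, (congrArg Subtype.val hc).symm⟩
  -- An invariant plane is the orthogonal complement of some `v`, and then the line of `v` is
  -- invariant as well.
  · obtain ⟨f, hf0, hNf⟩ := Submodule.exists_le_ker_of_lt_top N (lt_top_iff_ne_top.mpr hne)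
    have hker : N = LinearMap.ker f := by
      refine Submodule.eq_of_le_of_finrank_le hNf ?_
      rw [h2]
      have hk : Module.finrank ℍ[ℝ]ᵐᵒᵖ (LinearMap.ker f) < 3 :=
        (Submodule.finrank_lt fun h => hf0 (LinearMap.ker_eq_top.mp h)).trans_eq
          finrank_quaternion_op
      omega
    obtain ⟨v, hv⟩ := exists_herm_eq_functional f
    have hv0 : v ≠ 0 := by
      rintro rfl
      apply hf0
      refine LinearMap.ext fun x => unop_injective ?_
      rw [← hv, herm_zero_right]
      rfl
    have hperp : ∀ x, herm x v = 0 → x ∈ N := fun x hx => by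
      rw [hker, LinearMap.mem_ker]
      exact unop_injective ((hv x).symm.trans hx)
    have hperp' : ∀ x ∈ N, herm x v = 0 := fun x hx => by
      rw [hv, LinearMap.mem_ker.mp (hNf hx)]; rfl
    obtain ⟨q, hq⟩ := exists_herm_eq_one hv0
    refine hirr v hv0 fun g hg => ⟨star (herm ((g⁻¹).val *ᵥ q) v), ?_⟩
    refine eq_of_herm_right fun x => ?_
    have h1 : herm x (g.val *ᵥ v) = herm ((g⁻¹).val *ᵥ x) v := by
      rw [← herm_mulVec_mulVec (hG hg) ((g⁻¹).val *ᵥ x) v, mulVec_inv_mulVec]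
    rw [h1, herm_smul_right, star_star]
    have h2 : x + -(op (herm x v) • q) ∈ N := hperp _ (by
      rw [herm_add_left, herm_neg_left, herm_smul_left, hq, one_mul, add_neg_cancel])
    have h3 := hperp' _ (hinv g⁻¹ (G.inv_mem hg) _ h2)
    rw [Matrix.mulVec_add, Matrix.mulVec_neg, mulVec_op_smul, herm_add_left, herm_neg_left,
      herm_smul_left] at h3
    exact add_neg_eq_zero.mp h3

theorem exists_invertible_of_span_eq_top {S : Set (Fin 3 → ℍ[ℝ])}
    (hS : Submodule.span ℍ[ℝ]ᵐᵒᵖ S = ⊤) :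
    ∃ P Q : Matrix (Fin 3) (Fin 3) ℍ[ℝ], P * Q = 1 ∧ Q * P = 1 ∧ ∀ j, P.col j ∈ S := by
  obtain ⟨f, hfS, hspan, -⟩ := Submodule.exists_fun_fin_finrank_span_eq ℍ[ℝ]ᵐᵒᵖ S
  have hn : Module.finrank ℍ[ℝ]ᵐᵒᵖ (Submodule.span ℍ[ℝ]ᵐᵒᵖ S) = 3 := by
    rw [hS, finrank_top, finrank_quaternion_op]
  replace hspan := hspan.trans hS
  generalize Module.finrank ℍ[ℝ]ᵐᵒᵖ (Submodule.span ℍ[ℝ]ᵐᵒᵖ S) = n at f hn hfS hspan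
  subst hn
  have hex : ∀ i : Fin 3, ∃ c : Fin 3 → ℍ[ℝ]ᵐᵒᵖ, ∑ j, c j • f j = Pi.single i 1 := fun i =>
    (Submodule.mem_span_range_iff_exists_fun _).mp (by rw [hspan]; trivial)
  choose c hc using hex
  set P : Matrix (Fin 3) (Fin 3) ℍ[ℝ] := Matrix.of fun i j => f j i with hP
  set Q : Matrix (Fin 3) (Fin 3) ℍ[ℝ] := Matrix.of fun j i => unop (c i j) with hQ
  have hPQ : P * Q = 1 := by
    ext k i : 1
    have h1 := congrFun (hc i) k
    rw [Finset.sum_apply] at h1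
    rw [Matrix.mul_apply, Matrix.one_apply, ← Pi.single_apply, ← h1]
    rfl
  exact ⟨P, Q, hPQ, mul_eq_one_comm.mp hPQ, hfS⟩

/-! ### The real algebra spanned by a group -/

/-- The real span of a group of matrices. -/
def realSpan (G : Subgroup (GL (Fin 3) ℍ[ℝ])) : Submodule ℝ (Matrix (Fin 3) (Fin 3) ℍ[ℝ]) :=
  Submodule.span ℝ {m | ∃ g ∈ G, m = g.val}

theorem val_mem_realSpan {G : Subgroup (GL (Fin 3) ℍ[ℝ])} {g : GL (Fin 3) ℍ[ℝ]} (hg : g ∈ G) :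
    g.val ∈ realSpan G := Submodule.subset_span ⟨g, hg, rfl⟩

theorem mul_mem_realSpan {G : Subgroup (GL (Fin 3) ℍ[ℝ])} {a b : Matrix (Fin 3) (Fin 3) ℍ[ℝ]}
    (ha : a ∈ realSpan G) (hb : b ∈ realSpan G) : a * b ∈ realSpan G := by
  have h := Submodule.mul_mem_mul ha hb
  rw [realSpan, Submodule.span_mul_span] at h
  refine Submodule.span_mono ?_ h
  rintro _ ⟨_, ⟨g, hg, rfl⟩, _, ⟨k, hk, rfl⟩, rfl⟩
  exact ⟨g * k, G.mul_mem hg hk, rfl⟩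

theorem adj_mem_realSpan {G : Subgroup (GL (Fin 3) ℍ[ℝ])} (hG : G ≤ Sp21)
    {a : Matrix (Fin 3) (Fin 3) ℍ[ℝ]} (ha : a ∈ realSpan G) : adj a ∈ realSpan G := by
  induction ha using Submodule.span_induction with
  | mem x hx =>
    obtain ⟨g, hg, rfl⟩ := hx
    rw [adj_val (hG hg)]
    exact val_mem_realSpan (G.inv_mem hg)
  | zero => simp [adj]
  | add x y _ _ hx hy =>
    have : adj (x + y) = adj x + adj y := by
      simp only [adj, Matrix.conjTranspose_add, mul_add, add_mul]
    rw [this]; exact Submodule.add_mem _ hx hy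
  | smul t x _ hx =>
    have : adj (t • x) = t • adj x := by
      have h1 : (t • x)ᴴ = t • xᴴ := by
        ext i j : 1
        simp [Matrix.conjTranspose_apply, Quaternion.star_smul]
      rw [adj, adj, h1, mul_smul_comm, smul_mul_assoc]
    rw [this]; exact Submodule.smul_mem _ t hx

theorem trace_real_of_mem_realSpan {G : Subgroup (GL (Fin 3) ℍ[ℝ])}
    (htr : ∀ g ∈ G, HasRealTrace g) {a : Matrix (Fin 3) (Fin 3) ℍ[ℝ]} (ha : a ∈ realSpan G) :
    ∃ r : ℝ, Matrix.trace a = r := by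
  induction ha using Submodule.span_induction with
  | mem x hx =>
    obtain ⟨g, hg, rfl⟩ := hx
    exact htr g hg
  | zero => exact ⟨0, by simp⟩
  | add x y _ _ hx hy =>
    obtain ⟨r, hr⟩ := hx
    obtain ⟨s, hs⟩ := hy
    exact ⟨r + s, by rw [Matrix.trace_add, hr, hs, Quaternion.coe_add]⟩
  | smul t x _ hx =>
    obtain ⟨r, hr⟩ := hx
    exact ⟨t * r, by rw [Matrix.trace_smul, hr, ← Quaternion.coe_smul, smul_eq_mul]⟩

/-- The real span of an unbounded group contains a rank one matrix with null image. -/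
theorem exists_rank_one {G : Subgroup (GL (Fin 3) ℍ[ℝ])} (hG : G ≤ Sp21)
    (hunb : ∀ K : ℝ, ∃ g ∈ G, ∃ i j, K < ‖g.val i j‖) :
    ∃ u r : Fin 3 → ℍ[ℝ], u ≠ 0 ∧ r ≠ 0 ∧ herm u u = 0 ∧ Matrix.vecMulVec u r ∈ realSpan G := by
  let N : Matrix (Fin 3) (Fin 3) ℍ[ℝ] → ℝ := fun m => ∑ i, ∑ j, ‖m i j‖
  have hNc : Continuous N := by
    refine continuous_finsetSum _ fun i _ => continuous_finsetSum _ fun j _ => ?_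
    exact (continuous_id.matrix_elem i j).norm
  have hle : ∀ m i j, ‖m i j‖ ≤ N m := fun m i j =>
    (Finset.single_le_sum (f := fun j => ‖m i j‖) (fun _ _ => norm_nonneg _)
      (Finset.mem_univ j)).trans
      (Finset.single_le_sum (f := fun i => ∑ j, ‖m i j‖)
        (fun _ _ => Finset.sum_nonneg fun _ _ => norm_nonneg _) (Finset.mem_univ i))
  have hsmul : ∀ (t : ℝ) m, 0 ≤ t → N (t • m) = t * N m := fun t m ht => by
    simp only [N, Matrix.smul_apply, norm_smul, Real.norm_of_nonneg ht, Finset.mul_sum]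
  have hex : ∀ n : ℕ, ∃ g ∈ G, (n : ℝ) < N g.val := fun n => by
    obtain ⟨g, hg, i, j, h⟩ := hunb n
    exact ⟨g, hg, h.trans_le (hle _ i j)⟩
  choose g hgG hgN using hex
  have hpos : ∀ n, 0 < N (g n).val := fun n => (Nat.cast_nonneg n).trans_lt (hgN n)
  set X : ℕ → Matrix (Fin 3) (Fin 3) ℍ[ℝ] := fun n => (N (g n).val)⁻¹ • (g n).val with hX
  have hNX : ∀ n, N (X n) = 1 := fun n => by
    rw [hX, hsmul _ _ (inv_nonneg.mpr (hpos n).le), inv_mul_cancel₀ (hpos n).ne']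
  have : FirstCountableTopology (Matrix (Fin 3) (Fin 3) ℍ[ℝ]) :=
    inferInstanceAs (FirstCountableTopology (Fin 3 → Fin 3 → ℍ[ℝ]))
  obtain ⟨Y, -, φ, hφ, hlim⟩ := (isCompact_setOf_entries_le 1).tendsto_subseq
    (x := X) (fun n i j => (hle _ i j).trans (hNX n).le)
  have hYA : Y ∈ realSpan G := by
    have hcl : IsClosed (realSpan G : Set (Matrix (Fin 3) (Fin 3) ℍ[ℝ])) :=
      Submodule.closed_of_finiteDimensional _
    exact hcl.mem_of_tendsto hlim (Filter.Eventually.of_forall fun n =>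
      Submodule.smul_mem _ _ (val_mem_realSpan (hgG _)))
  have hNY : N Y = 1 := by
    refine tendsto_nhds_unique ((hNc.tendsto Y).comp hlim) ?_
    simp only [Function.comp_def, hNX]
    exact tendsto_const_nhds
  -- The relation `g* J g = J` rescales to `X* J X = N(g)⁻² J`, which tends to zero. The columns of
  -- `Y` are thus null and mutually orthogonal, hence proportional.
  have hYJ : ∀ i j, herm (Y.col j) (Y.col i) = 0 := fun i j => by
    have hcont : Continuous fun m : Matrix (Fin 3) (Fin 3) ℍ[ℝ] => herm (m.col j) (m.col i) := by
      simp only [herm_eq, Matrix.col_apply]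
      fun_prop
    have h1 := (hcont.tendsto Y).comp hlim
    have h2 : ∀ n, herm ((X n).col j) ((X n).col i) =
        ((N (g n).val)⁻¹ * (N (g n).val)⁻¹) • formJ ℍ[ℝ] i j := fun n => by
      have h3 : ∀ k, (X n).col k = (N (g n).val)⁻¹ • (g n).val.col k := fun k => rfl
      rw [h3, h3, herm_real_smul_left, herm_real_smul_right, herm_col (hG (hgG n)), smul_smul]
    have h4 : Filter.Tendsto (fun n => (N (g n).val)⁻¹) Filter.atTop (𝓝 0) :=
      (Filter.tendsto_atTop_mono (fun n => (hgN n).le) tendsto_natCast_atTop_atTop).inv_tendsto_atTop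
    have h5 := ((h4.mul h4).smul_const (formJ ℍ[ℝ] i j)).comp hφ.tendsto_atTop
    rw [mul_zero, zero_smul] at h5
    refine tendsto_nhds_unique h1 ?_
    simpa only [Function.comp_def, h2] using h5
  have hY0 : Y ≠ 0 := by
    rintro rfl
    simp [N] at hNY
  obtain ⟨j₀, hj₀⟩ : ∃ j, Y.col j ≠ 0 := by
    by_contra! h
    exact hY0 (by ext i j : 1; exact congrFun (h j) i)
  have hcol : ∀ j, ∃ c : ℍ[ℝ], Y.col j = op c • Y.col j₀ := fun j =>
    exists_eq_smul_of_orthogonal hj₀ (by simp [hYJ]) (by simp [hYJ]) (hYJ _ _)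
  choose r hr using hcol
  have hYr : Y = Matrix.vecMulVec (Y.col j₀) r := by
    ext i j : 1
    exact congrFun (hr j) i
  refine ⟨Y.col j₀, r, hj₀, ?_, hYJ _ _, hYr ▸ hYA⟩
  rintro rfl
  apply hY0
  rw [hYr, Matrix.vecMulVec_zero]

/-! ### Reality of the coefficients -/

theorem star_eq_neg_of_re_eq_zero {q : ℍ[ℝ]} (hq : q.re = 0) : star q = -q := by
  ext <;> simp [hq]

theorem mul_anticomm_of_re_eq_zero {h p : ℍ[ℝ]} (hh : h.re = 0) (hp : p.re = 0)
    (hhp : (h * p).re = 0) : h * p = -(p * h) := by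
  have h1 := star_eq_neg_of_re_eq_zero hhp
  rw [star_mul, star_eq_neg_of_re_eq_zero hh, star_eq_neg_of_re_eq_zero hp, neg_mul_neg] at h1
  rw [h1, neg_neg]

/-- The quaternion unit `i`. -/
@[simps]
def qI : ℍ[ℝ] := ⟨0, 1, 0, 0⟩

/-- The quaternion unit `j`. -/
@[simps]
def qJ : ℍ[ℝ] := ⟨0, 0, 1, 0⟩

/-- The quaternion unit `k`. -/
@[simps]
def qK : ℍ[ℝ] := ⟨0, 0, 0, 1⟩

theorem qI_mul_qJ : qI * qJ = qK := by ext <;> simp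

theorem qJ_mul_qK : qJ * qK = qI := by ext <;> simp

theorem qJ_ne_zero : qJ ≠ 0 := fun h => by simpa using congrArg (fun q : ℍ[ℝ] => q.imJ) h

theorem qK_ne_zero : qK ≠ 0 := fun h => by simpa using congrArg (fun q : ℍ[ℝ] => q.imK) h

theorem eq_coe_of_commute {q : ℍ[ℝ]} (hI : qI * q = q * qI) (hJ : qJ * q = q * qJ) :
    q = (q.re : ℍ[ℝ]) := by
  have h1 := congrArg (fun q : ℍ[ℝ] => q.imJ) hI
  have h2 := congrArg (fun q : ℍ[ℝ] => q.imK) hI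
  have h3 := congrArg (fun q : ℍ[ℝ] => q.imK) hJ
  simp at h1 h2 h3
  ext <;> simp <;> linarith

/-- A `3 × 3` quaternionic matrix commuting with scalars does not square to a negative scalar. -/
theorem not_exists_sq_neg {N : Matrix (Fin 3) (Fin 3) ℍ[ℝ]} {c : ℝ} (hc : 0 < c)
    (hI : Matrix.scalar (Fin 3) qI * N = N * Matrix.scalar (Fin 3) qI)
    (hJ : Matrix.scalar (Fin 3) qJ * N = N * Matrix.scalar (Fin 3) qJ)
    (hN : N * N = Matrix.scalar (Fin 3) ((-c : ℝ) : ℍ[ℝ])) : False := by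
  have hreal : N = (Matrix.of fun i j => (N i j).re).map (fun r : ℝ => (r : ℍ[ℝ])) := by
    ext i j : 1
    refine eq_coe_of_commute ?_ ?_
    · simpa [Matrix.scalar_apply, Matrix.diagonal_mul, Matrix.mul_diagonal] using
        congrFun (congrFun hI i) j
    · simpa [Matrix.scalar_apply, Matrix.diagonal_mul, Matrix.mul_diagonal] using
        congrFun (congrFun hJ i) j
  set M : Matrix (Fin 3) (Fin 3) ℝ := Matrix.of fun i j => (N i j).re
  have hs : Matrix.scalar (Fin 3) ((-c : ℝ) : ℍ[ℝ]) =
      (Matrix.diagonal fun _ => -c : Matrix (Fin 3) (Fin 3) ℝ).map (fun r : ℝ => (r : ℍ[ℝ])) := by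
    rw [Matrix.diagonal_map Quaternion.coe_zero]
    rfl
  rw [hreal, ← map_coe_mul, hs] at hN
  -- `N` is a real matrix, so its determinant would have square `(-c)³ < 0`.
  have h1 := congrArg Matrix.det (Matrix.map_injective Quaternion.coe_injective hN)
  rw [Matrix.det_mul, Matrix.det_diagonal, Fin.prod_univ_three] at h1
  nlinarith [mul_self_nonneg M.det, mul_pos (mul_pos hc hc) hc]

/-- Moving `P` and `R` to the other side turns the hypothesis into `s Q₁ = -Q₂ s` for all imaginary
`s`, with `Q₁`, `Q₂` conjugate to the scalar matrix `p`. Comparing `s = b` with `s = a b` shows that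
`Q₂` commutes with `i` and `j`, hence is real, while `Q₂² = p² = -|p|²`. -/
theorem not_forall_anticomm {P Q R T : Matrix (Fin 3) (Fin 3) ℍ[ℝ]} (hPQ : P * Q = 1)
    (hRT : R * T = 1) {p : ℍ[ℝ]} (hp : p.re = 0) (hp0 : p ≠ 0)
    (h : ∀ s : ℍ[ℝ], s.re = 0 → R * Matrix.scalar (Fin 3) s * P * Matrix.scalar (Fin 3) p =
      -(Matrix.scalar (Fin 3) p * (R * Matrix.scalar (Fin 3) s * P))) : False := by
  have hTR : T * R = 1 := mul_eq_one_comm.mp hRT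
  set Q₁ := P * Matrix.scalar (Fin 3) p * Q with hQ₁
  set Q₂ := T * Matrix.scalar (Fin 3) p * R with hQ₂
  have key : ∀ s : ℍ[ℝ], s.re = 0 →
      Matrix.scalar (Fin 3) s * Q₁ = -(Q₂ * Matrix.scalar (Fin 3) s) := fun s hs => by
    have h1 := congrArg (fun X => T * X * Q) (h s hs)
    calc _ = (T * R) * Matrix.scalar (Fin 3) s * Q₁ := by rw [hTR, one_mul]
      _ = T * (R * Matrix.scalar (Fin 3) s * P * Matrix.scalar (Fin 3) p) * Q := by
          rw [hQ₁]; simp only [mul_assoc]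
      _ = _ := h1
      _ = -(Q₂ * Matrix.scalar (Fin 3) s * (P * Q)) := by
          rw [hQ₂]; simp only [mul_assoc, mul_neg, neg_mul]
      _ = _ := by rw [hPQ, mul_one]
  clear_value Q₁ Q₂
  have comm : ∀ a b : ℍ[ℝ], a.re = 0 → b.re = 0 → (a * b).re = 0 → b ≠ 0 →
      Matrix.scalar (Fin 3) a * Q₂ = Q₂ * Matrix.scalar (Fin 3) a := by
    intro a b ha hb hab hb0
    have h1 := key _ hab
    rw [map_mul, mul_assoc, key b hb, mul_neg, neg_inj, ← mul_assoc, ← mul_assoc] at h1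
    have h2 : Matrix.scalar (Fin 3) b * Matrix.scalar (Fin 3) b⁻¹ = 1 := by
      rw [← map_mul, mul_inv_cancel₀ hb0, map_one]
    have h3 := congrArg (· * Matrix.scalar (Fin 3) b⁻¹) h1
    rwa [mul_assoc, h2, mul_one, mul_assoc, h2, mul_one] at h3
  have hpp : p * p = ((-Quaternion.normSq p : ℝ) : ℍ[ℝ]) := by
    rw [Quaternion.coe_neg, ← Quaternion.star_mul_self, star_eq_neg_of_re_eq_zero hp, neg_mul, neg_neg]
  have hc : 0 < Quaternion.normSq p :=
    lt_of_le_of_ne Quaternion.normSq_nonneg (Quaternion.normSq_ne_zero.mpr hp0).symm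
  refine not_exists_sq_neg hc (comm qI qJ rfl rfl (by rw [qI_mul_qJ]; rfl) qJ_ne_zero)
    (comm qJ qK rfl rfl (by rw [qJ_mul_qK]; rfl) qK_ne_zero) ?_
  calc Q₂ * Q₂ = T * Matrix.scalar (Fin 3) p * (R * T) * Matrix.scalar (Fin 3) p * R := by
        rw [hQ₂]; simp only [mul_assoc]
    _ = T * Matrix.scalar (Fin 3) (p * p) * R := by
        rw [hRT, mul_one, map_mul]; simp only [mul_assoc]
    _ = Matrix.scalar (Fin 3) (p * p) * (T * R) := by
        rw [hpp, ← mul_assoc]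
        congr 1
        refine (Matrix.scalar_commute _ (fun r => ?_) T).eq.symm
        exact Quaternion.coe_commutes _ _
    _ = _ := by rw [hTR, mul_one, hpp]

/-- The quaternionic trace is not cyclic, but its real part is. -/
theorem re_dotProduct_mul_comm (x ρ : Fin 3 → ℍ[ℝ]) (s p : ℍ[ℝ]) :
    (∑ i, ρ i * s * (x i * p)).re = ((∑ i, x i * p * ρ i) * s).re := by
  simp only [Fin.sum_univ_three, Quaternion.re_add, Quaternion.re_mul, Quaternion.imI_mul,
    Quaternion.imJ_mul, Quaternion.imK_mul, Quaternion.imI_add, Quaternion.imJ_add,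
    Quaternion.imK_add]
  ring

theorem vecMulVec_mulVec' (u r x : Fin 3 → ℍ[ℝ]) :
    Matrix.vecMulVec u r *ᵥ x = op (r ⬝ᵥ x) • u := by
  funext i
  simp only [Matrix.mulVec, dotProduct, Matrix.vecMulVec_apply, Pi.smul_apply, op_smul_eq_mul,
    Finset.mul_sum, mul_assoc]

theorem vecMulVec_mul_vecMulVec' (u r v s : Fin 3 → ℍ[ℝ]) :
    Matrix.vecMulVec u r * Matrix.vecMulVec v s = Matrix.vecMulVec u ((r ⬝ᵥ v) • s) := by
  ext i j : 1
  simp only [Matrix.mul_apply, dotProduct, Matrix.vecMulVec_apply, Pi.smul_apply, smul_eq_mul,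
    Finset.mul_sum, Finset.sum_mul, mul_assoc]

theorem mul_scalar_apply (N : Matrix (Fin 3) (Fin 3) ℍ[ℝ]) (p : ℍ[ℝ]) (i j : Fin 3) :
    (N * Matrix.scalar (Fin 3) p) i j = N i j * p := Matrix.mul_diagonal _ _ _ _

theorem scalar_mul_apply (N : Matrix (Fin 3) (Fin 3) ℍ[ℝ]) (p : ℍ[ℝ]) (i j : Fin 3) :
    (Matrix.scalar (Fin 3) p * N) i j = p * N i j := Matrix.diagonal_mul _ _ _ _

theorem trace_vecMulVec' (u r : Fin 3 → ℍ[ℝ]) :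
    Matrix.trace (Matrix.vecMulVec u r) = ∑ i, u i * r i := rfl

theorem mul_vecMulVec_mul (a b : Matrix (Fin 3) (Fin 3) ℍ[ℝ]) (u r : Fin 3 → ℍ[ℝ]) :
    a * Matrix.vecMulVec u r * b = Matrix.vecMulVec (a *ᵥ u) (r ᵥ* b) := by
  rw [Matrix.mul_vecMulVec, Matrix.vecMulVec_mul]

/-- Write `X = u r`, and let `p` be the imaginary part of `r a u`. The traces of `b X c` and `b X a
X c` are real, hence so are `∑ (b u)ᵢ (r c)ᵢ` and `∑ (b u)ᵢ p (r c)ᵢ`. For imaginary `s`, cyclicity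
of the real part makes `η = ∑ (r c)ᵢ s (b u)ᵢ` satisfy `Re η = Re (η p) = 0`, so `η` anticommutes
with `p`. Letting `b u` and `r c` run through bases contradicts `not_forall_anticomm` unless `p =
0`. -/
theorem dotProduct_mulVec_real {A : Submodule ℝ (Matrix (Fin 3) (Fin 3) ℍ[ℝ])}
    (hmul : ∀ a ∈ A, ∀ b ∈ A, a * b ∈ A) (hadj : ∀ a ∈ A, adj a ∈ A)
    (htr : ∀ a ∈ A, ∃ t : ℝ, Matrix.trace a = t)
    (hbasis : ∀ v : Fin 3 → ℍ[ℝ], v ≠ 0 → ∃ P Q : Matrix (Fin 3) (Fin 3) ℍ[ℝ],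
      P * Q = 1 ∧ Q * P = 1 ∧ ∀ j, ∃ a ∈ A, P.col j = a *ᵥ v)
    {u r : Fin 3 → ℍ[ℝ]} (hu : u ≠ 0) (hr : r ≠ 0) (hX : Matrix.vecMulVec u r ∈ A)
    {a : Matrix (Fin 3) (Fin 3) ℍ[ℝ]} (ha : a ∈ A) : ∃ t : ℝ, r ⬝ᵥ (a *ᵥ u) = t := by
  set d := r ⬝ᵥ (a *ᵥ u) with hd
  set p : ℍ[ℝ] := d.im with hp
  have hpre : p.re = 0 := rfl
  by_cases hp0 : p = 0
  · exact ⟨d.re, by rw [← Quaternion.re_add_im d, ← hp, hp0]; simp⟩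
  exfalso
  have htr1 : ∀ b ∈ A, ∀ c ∈ A, ∃ t : ℝ, ∑ i, (b *ᵥ u) i * (r ᵥ* c) i = t := fun b hb c hc => by
    have := htr _ (hmul _ (hmul b hb _ hX) c hc)
    rwa [mul_vecMulVec_mul, trace_vecMulVec'] at this
  have htr2 : ∀ b ∈ A, ∀ c ∈ A, ∃ t : ℝ, ∑ i, (b *ᵥ u) i * p * (r ᵥ* c) i = t := fun b hb c hc => by
    have h1 := htr _ (hmul _ (hmul _ (hmul b hb _ hX) a ha) _ (hmul _ hX c hc))
    rw [Matrix.vecMulVec_mul, Matrix.mul_vecMulVec b, Matrix.vecMulVec_mul,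
      vecMulVec_mul_vecMulVec', ← Matrix.dotProduct_mulVec, ← hd, trace_vecMulVec'] at h1
    obtain ⟨t, ht⟩ := h1
    obtain ⟨t', ht'⟩ := htr1 b hb c hc
    refine ⟨t - d.re * t', ?_⟩
    rw [Quaternion.coe_sub, Quaternion.coe_mul, ← ht, ← ht', Finset.mul_sum,
      ← Finset.sum_sub_distrib]
    refine Finset.sum_congr rfl fun i _ => ?_
    have hdp : p = d - (d.re : ℍ[ℝ]) := by rw [hp, eq_sub_iff_add_eq', Quaternion.re_add_im]
    rw [hdp, mul_sub, sub_mul, Pi.smul_apply, smul_eq_mul, ← Quaternion.coe_commutes, mul_assoc,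
      mul_assoc]
  obtain ⟨P, Q, hPQ, -, hP⟩ := hbasis u hu
  choose α hαA hα using hP
  -- The row `r` is `w* J`, so a basis of columns `β w` becomes a basis of rows `r (adj β)`.
  set w : Fin 3 → ℍ[ℝ] := formJ ℍ[ℝ] *ᵥ star r with hw
  have hJw : star w ᵥ* formJ ℍ[ℝ] = r := by
    rw [hw, Matrix.star_mulVec, star_star, Matrix.vecMul_vecMul, formJ_conjTranspose,
      formJ_mul_formJ, Matrix.vecMul_one]
  have hw0 : w ≠ 0 := by
    intro h0
    rw [h0, star_zero, Matrix.zero_vecMul] at hJw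
    exact hr hJw.symm
  obtain ⟨W, V, hWV, hVW, hW⟩ := hbasis w hw0
  choose β hβA hβ using hW
  have hRT : (Wᴴ * formJ ℍ[ℝ]) * (formJ ℍ[ℝ] * Vᴴ) = 1 := by
    rw [mul_assoc, ← mul_assoc (formJ ℍ[ℝ]), formJ_mul_formJ, one_mul, ← Matrix.conjTranspose_mul,
      hVW, Matrix.conjTranspose_one]
  have hrow : ∀ i, (Wᴴ * formJ ℍ[ℝ]) i = r ᵥ* adj (β i) := fun i => by
    have h1 : (Wᴴ * formJ ℍ[ℝ]) i = star (W.col i) ᵥ* formJ ℍ[ℝ] := by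
      funext k
      rw [Matrix.mul_apply, Matrix.vecMul, dotProduct]
      rfl
    rw [h1, hβ, Matrix.star_mulVec, ← hJw, Matrix.vecMul_vecMul, Matrix.vecMul_vecMul, adj,
      ← mul_assoc, ← mul_assoc, formJ_mul_formJ, one_mul]
  refine not_forall_anticomm hPQ hRT hpre hp0 fun s hs => ?_
  have hentry : ∀ i j, (Wᴴ * formJ ℍ[ℝ] * Matrix.scalar (Fin 3) s * P) i j =
      ∑ k, (r ᵥ* adj (β i)) k * s * (α j *ᵥ u) k := fun i j => by
    rw [Matrix.mul_apply]
    refine Finset.sum_congr rfl fun k _ => ?_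
    rw [mul_scalar_apply, hrow, ← hα]
    rfl
  ext i j : 1
  rw [Matrix.neg_apply, mul_scalar_apply, scalar_mul_apply, hentry]
  refine mul_anticomm_of_re_eq_zero ?_ hpre ?_
  · obtain ⟨t, ht⟩ := htr1 _ (hαA j) _ (hadj _ (hβA i))
    have := re_dotProduct_mul_comm (α j *ᵥ u) (r ᵥ* adj (β i)) s 1
    simp only [mul_one] at this
    rw [this, ht]
    simp [hs]
  · obtain ⟨t, ht⟩ := htr2 _ (hαA j) _ (hadj _ (hβA i))
    rw [Finset.sum_mul]
    simp only [mul_assoc _ _ p]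
    rw [re_dotProduct_mul_comm, ht]
    simp [hs]

theorem exists_dotProduct_ne_zero {A : Submodule ℝ (Matrix (Fin 3) (Fin 3) ℍ[ℝ])}
    (hbasis : ∀ v : Fin 3 → ℍ[ℝ], v ≠ 0 → ∃ P Q : Matrix (Fin 3) (Fin 3) ℍ[ℝ],
      P * Q = 1 ∧ Q * P = 1 ∧ ∀ j, ∃ a ∈ A, P.col j = a *ᵥ v)
    {u r : Fin 3 → ℍ[ℝ]} (hu : u ≠ 0) (hr : r ≠ 0) : ∃ a ∈ A, r ⬝ᵥ (a *ᵥ u) ≠ 0 := by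
  by_contra! h
  obtain ⟨P, Q, hPQ, -, hP⟩ := hbasis u hu
  apply hr
  have h1 : r ᵥ* P = 0 := by
    funext j
    obtain ⟨a, ha, hPa⟩ := hP j
    have := h a ha
    rw [← hPa] at this
    exact this
  rw [← Matrix.vecMul_one r, ← hPQ, ← Matrix.vecMul_vecMul, h1, Matrix.zero_vecMul]

/-! ### The real form -/

theorem real_of_coe_mul_real {t : ℝ} (ht : t ≠ 0) {q : ℍ[ℝ]}
    (h : ∃ s : ℝ, (t : ℍ[ℝ]) * q = s) : ∃ s : ℝ, q = s := by
  obtain ⟨s, hs⟩ := h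
  refine ⟨t⁻¹ * s, ?_⟩
  rw [Quaternion.coe_mul, ← hs, ← mul_assoc, ← Quaternion.coe_mul, inv_mul_cancel₀ ht,
    Quaternion.coe_one, one_mul]

theorem star_vecMul_formJ_dotProduct (u x : Fin 3 → ℍ[ℝ]) :
    (star u ᵥ* formJ ℍ[ℝ]) ⬝ᵥ x = herm x u := by
  rw [← Matrix.dotProduct_mulVec, herm]

theorem adj_adj (a : Matrix (Fin 3) (Fin 3) ℍ[ℝ]) : adj (adj a) = a := by
  simp only [adj, Matrix.conjTranspose_mul, formJ_conjTranspose, Matrix.conjTranspose_conjTranspose]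
  rw [mul_assoc, mul_assoc, mul_assoc, formJ_mul_formJ, mul_one, ← mul_assoc, formJ_mul_formJ,
    one_mul]

theorem adj_vecMulVec (u r : Fin 3 → ℍ[ℝ]) : adj (Matrix.vecMulVec u r) =
    Matrix.vecMulVec (formJ ℍ[ℝ] *ᵥ star r) (star u ᵥ* formJ ℍ[ℝ]) := by
  rw [adj, Matrix.conjTranspose_vecMulVec, Matrix.mul_vecMulVec, Matrix.vecMulVec_mul]

/-- Up to a common left factor, the form is real on the real span of the orbit. -/
theorem exists_left_factor_real {A : Submodule ℝ (Matrix (Fin 3) (Fin 3) ℍ[ℝ])}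
    (hmul : ∀ a ∈ A, ∀ b ∈ A, a * b ∈ A) (hadj : ∀ a ∈ A, adj a ∈ A)
    (htr : ∀ a ∈ A, ∃ t : ℝ, Matrix.trace a = t)
    (hbasis : ∀ v : Fin 3 → ℍ[ℝ], v ≠ 0 → ∃ P Q : Matrix (Fin 3) (Fin 3) ℍ[ℝ],
      P * Q = 1 ∧ Q * P = 1 ∧ ∀ j, ∃ a ∈ A, P.col j = a *ᵥ v)
    {u r : Fin 3 → ℍ[ℝ]} (hu : u ≠ 0) (hr : r ≠ 0) (hX : Matrix.vecMulVec u r ∈ A) :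
    ∃ d : ℍ[ℝ], d ≠ 0 ∧ ∀ a ∈ A, ∀ b ∈ A, ∃ t : ℝ, d * herm (a *ᵥ u) (b *ᵥ u) = t := by
  set w : Fin 3 → ℍ[ℝ] := formJ ℍ[ℝ] *ᵥ star r with hw
  have hw0 : w ≠ 0 := by
    intro h0
    apply hr
    rw [← star_eq_zero, ← Matrix.one_mulVec (star r), ← formJ_mul_formJ, ← Matrix.mulVec_mulVec,
      ← hw, h0, Matrix.mulVec_zero]
  obtain ⟨b, hb, hd⟩ := exists_dotProduct_ne_zero hbasis hw0 hr
  obtain ⟨c, hc, hcu⟩ := exists_dotProduct_ne_zero hbasis hu hr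
  refine ⟨r ⬝ᵥ (b *ᵥ w), hd, ?_⟩
  have key : ∀ a ∈ A, ∃ t : ℝ, r ⬝ᵥ (b *ᵥ w) * herm (a *ᵥ u) u = t := fun a ha => by
    obtain ⟨s, hs⟩ := dotProduct_mulVec_real hmul hadj htr hbasis hu hr hX hc
    -- With `X = u r`, evaluating `r · u` on this product gives `(r c u) (r b w) ⟨a u, u⟩`; the
    -- first factor is real and nonzero and can be cancelled.
    have hm : c * (Matrix.vecMulVec u r * (b * (adj (Matrix.vecMulVec u r) * a))) ∈ A :=
      hmul _ hc _ (hmul _ hX _ (hmul _ hb _ (hmul _ (hadj _ hX) _ ha)))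
    have h1 := dotProduct_mulVec_real hmul hadj htr hbasis hu hr hX hm
    rw [← Matrix.mulVec_mulVec, ← Matrix.mulVec_mulVec, ← Matrix.mulVec_mulVec,
      ← Matrix.mulVec_mulVec, adj_vecMulVec, ← hw, vecMulVec_mulVec' w,
      star_vecMul_formJ_dotProduct, mulVec_op_smul, vecMulVec_mulVec', mulVec_op_smul, dotProduct_smul,
      dotProduct_smul, op_smul_eq_mul, op_smul_eq_mul, hs] at h1
    exact real_of_coe_mul_real (fun h0 => hcu (by rw [hs, h0, Quaternion.coe_zero])) h1
  intro a ha b' hb'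
  obtain ⟨t, ht⟩ := key (adj b' * a) (hmul _ (hadj _ hb') _ ha)
  refine ⟨t, ?_⟩
  rw [← ht, ← Matrix.mulVec_mulVec, herm_mulVec (adj b'), adj_adj]

theorem exists_real_frame {A : Submodule ℝ (Matrix (Fin 3) (Fin 3) ℍ[ℝ])} (hone : 1 ∈ A)
    (hbasis : ∀ v : Fin 3 → ℍ[ℝ], v ≠ 0 → ∃ P Q : Matrix (Fin 3) (Fin 3) ℍ[ℝ],
      P * Q = 1 ∧ Q * P = 1 ∧ ∀ j, ∃ a ∈ A, P.col j = a *ᵥ v)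
    {u : Fin 3 → ℍ[ℝ]} (hu : u ≠ 0) (huu : herm u u = 0) {d : ℍ[ℝ]} (hd : d ≠ 0)
    (hreal : ∀ a ∈ A, ∀ b ∈ A, ∃ t : ℝ, d * herm (a *ᵥ u) (b *ᵥ u) = t) :
    (∀ a ∈ A, ∀ b ∈ A, ∃ t : ℝ, herm (a *ᵥ u) (b *ᵥ u) = t) ∧
      ∃ C ∈ Sp21, ∀ j, ∃ a ∈ A, C.val.col j = a *ᵥ u := by
  obtain ⟨P, Q, hPQ, hQP, hP⟩ := hbasis u hu
  choose α hαA hα using hP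
  obtain ⟨a₀, ha₀, hy₀⟩ : ∃ a ∈ A, herm (a *ᵥ u) u ≠ 0 := by
    by_contra! h
    refine hu (herm_nondegenerate fun q => herm_eq_zero_comm.mp ?_)
    have hq : q = ∑ j, op ((Q *ᵥ q) j) • P.col j := by
      conv_lhs => rw [← Matrix.one_mulVec q, ← hPQ, ← Matrix.mulVec_mulVec]
      funext i
      rw [Finset.sum_apply]
      rfl
    rw [hq, Fin.sum_univ_three, herm_add_left, herm_add_left, herm_smul_left, herm_smul_left,
      herm_smul_left]
    simp only [hα, h _ (hαA _), zero_mul, add_zero]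
  have hone' : (1 : Matrix (Fin 3) (Fin 3) ℍ[ℝ]) *ᵥ u = u := Matrix.one_mulVec u
  -- a vector of the real form orthogonal to `u` and `a₀ u`
  obtain ⟨z, hzA, hz0, hzu, hzy⟩ : ∃ z, z ∈ A ∧ z *ᵥ u ≠ 0 ∧ herm (z *ᵥ u) u = 0 ∧
      herm (z *ᵥ u) (a₀ *ᵥ u) = 0 := by
    let L : (Fin 3 → ℝ) →ₗ[ℝ] Matrix (Fin 3) (Fin 3) ℍ[ℝ] := Fintype.linearCombination ℝ α
    let E : Matrix (Fin 3) (Fin 3) ℍ[ℝ] →ₗ[ℝ] (Fin 3 → ℍ[ℝ]) :=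
      { toFun := fun m => m *ᵥ u
        map_add' := fun m n => Matrix.add_mulVec m n u
        map_smul' := fun t m => Matrix.smul_mulVec t m u }
    let F : (Fin 3 → ℍ[ℝ]) → (Fin 3 → ℍ[ℝ]) →ₗ[ℝ] ℝ := fun q =>
      { toFun := fun p => (d * herm p q).re
        map_add' := fun p p' => by rw [herm_add_left, mul_add, Quaternion.re_add]
        map_smul' := fun t p => by
          rw [herm_real_smul_left, mul_smul_comm, Quaternion.re_smul, RingHom.id_apply] }
    have hlt : Module.finrank ℝ (ℝ × ℝ) < Module.finrank ℝ (Fin 3 → ℝ) := by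
      simp
    have hk := LinearMap.ker_ne_bot_of_finrank_lt
      (f := ((F u).prod (F (a₀ *ᵥ u))) ∘ₗ E ∘ₗ L) hlt
    obtain ⟨t, ht, ht0⟩ := Submodule.exists_mem_ne_zero_of_ne_bot hk
    rw [LinearMap.mem_ker, LinearMap.comp_apply, LinearMap.prod_apply, Function.prod_apply,
      Prod.mk_eq_zero] at ht
    have hLA : L t ∈ A := by
      rw [Fintype.linearCombination_apply]
      exact Submodule.sum_mem _ fun j _ => Submodule.smul_mem _ _ (hαA j)
    have hzero : ∀ b ∈ A, (d * herm (L t *ᵥ u) (b *ᵥ u)).re = 0 →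
        herm (L t *ᵥ u) (b *ᵥ u) = 0 := fun b hb h0 => by
      obtain ⟨s, hs⟩ := hreal _ hLA b hb
      rw [hs, Quaternion.re_coe] at h0
      rw [h0, Quaternion.coe_zero] at hs
      exact (mul_eq_zero.mp hs).resolve_left hd
    refine ⟨L t, hLA, fun h0 => ht0 ?_, ?_, hzero _ ha₀ ht.2⟩
    · have h1 : L t *ᵥ u = P *ᵥ fun j => (t j : ℍ[ℝ]) := by
        change E (L t) = _
        rw [Fintype.linearCombination_apply, map_sum]
        funext i
        rw [Finset.sum_apply]
        change ∑ j, E (t j • α j) i = ∑ j, P i j * (t j : ℍ[ℝ])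
        refine Finset.sum_congr rfl fun j _ => ?_
        rw [map_smul, Pi.smul_apply, Quaternion.mul_coe_eq_smul]
        change t j • (α j *ᵥ u) i = _
        rw [← hα]
        rfl
      have h2 : Q *ᵥ (L t *ᵥ u) = fun j => (t j : ℍ[ℝ]) := by
        rw [h1, Matrix.mulVec_mulVec, hQP, Matrix.one_mulVec]
      rw [h0, Matrix.mulVec_zero] at h2
      funext j
      exact (Quaternion.coe_injective (congrFun h2 j)).symm
    · have := hzero 1 hone (by rw [hone']; exact ht.1)
      rwa [hone'] at this
  have hzpos : 0 < (herm (z *ᵥ u) (z *ᵥ u)).re := by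
    set y := a₀ *ᵥ u
    set b := herm y u with hb
    -- Adding the multiple `u α` changes the norm of `y` by `-2 t`, so `y + u α` has norm `-2`. As
    -- `z u` is orthogonal to it, `z u` is positive.
    set t := (herm y y).re / 2 + 1 with ht
    set α := star (-(t • b⁻¹)) with hαdef
    refine herm_self_pos_of_orthogonal (v := y + op α • u) ?_ hz0 ?_
    · have h1 : star α * b = ((-t : ℝ) : ℍ[ℝ]) := by
        rw [hαdef, star_star, neg_mul, smul_mul_assoc, inv_mul_cancel₀ hy₀, Quaternion.coe_neg]
        congr 1
        rw [← mul_one (t : ℍ[ℝ]), Quaternion.coe_mul_eq_smul]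
      have h2 : star b * α = ((-t : ℝ) : ℍ[ℝ]) := by
        rw [← star_star α, ← star_mul, h1, Quaternion.star_coe]
      rw [herm_add_left, herm_add_right, herm_add_right, herm_smul_left, herm_smul_left,
        herm_smul_right, herm_smul_right, huu, mul_zero, zero_mul, add_zero, ← hb, h1,
        ← star_herm y u, ← hb, h2]
      simp only [Quaternion.re_add, Quaternion.re_coe]
      linarith
    · rw [herm_add_right, herm_smul_right, hzu, hzy, mul_zero, add_zero]
  -- The form is real and nonzero at `z u` paired with itself, so the reality of `d ⟨z u, z u⟩`
  -- passes to `d`.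
  have hdreal : ∃ s : ℝ, s ≠ 0 ∧ d = s := by
    obtain ⟨s, hs⟩ := hreal z hzA z hzA
    rw [herm_self_eq_coe, ← Quaternion.coe_commutes] at hs
    obtain ⟨s', hs'⟩ := real_of_coe_mul_real hzpos.ne' ⟨s, hs⟩
    exact ⟨s', fun h0 => hd (by rw [hs', h0, Quaternion.coe_zero]), hs'⟩
  obtain ⟨s, hs0, rfl⟩ := hdreal
  have hreal' : ∀ a ∈ A, ∀ b ∈ A, ∃ t : ℝ, herm (a *ᵥ u) (b *ᵥ u) = t := fun a ha b hb =>
    real_of_coe_mul_real hs0 (hreal a ha b hb)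
  refine ⟨hreal', ?_⟩
  obtain ⟨t, hf⟩ := exists_normalized_of_pos hzpos
  obtain ⟨β, hβ⟩ := hreal' a₀ ha₀ 1 hone
  obtain ⟨γ, hγ⟩ := hreal' a₀ ha₀ a₀ ha₀
  rw [hone'] at hβ
  have hβ0 : β ≠ 0 := fun h0 => hy₀ (by rw [hβ, h0, Quaternion.coe_zero])
  have hβ' : herm u (a₀ *ᵥ u) = β := by rw [← star_herm, hβ, Quaternion.star_coe]
  -- The first coefficient normalizes the product with `u`; the second cancels the norm `γ / β²` of
  -- the first term.
  set y := β⁻¹ • (a₀ *ᵥ u) + (-(γ / (2 * β ^ 2))) • u with hy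
  have hyu : herm y u = 1 := by
    rw [hy, herm_add_left, herm_real_smul_left, herm_real_smul_left, huu, smul_zero, add_zero, hβ,
      ← Quaternion.coe_smul, smul_eq_mul, inv_mul_cancel₀ hβ0, Quaternion.coe_one]
  have hyy : herm y y = 0 := by
    rw [hy]
    simp only [herm_add_left, herm_add_right, herm_real_smul_left, herm_real_smul_right, huu, hβ,
      hβ', hγ, ← Quaternion.coe_smul, ← Quaternion.coe_add, smul_zero, add_zero, smul_eq_mul]
    rw [← Quaternion.coe_zero]
    congr 1
    field_simp
    ring
  obtain ⟨C, hC, h0, h1, h2⟩ := exists_mem_Sp21_of_frame (e := u) (f := t • (z *ᵥ u)) (y := y)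
    huu hyy hyu hf (by rw [herm_real_smul_left, hzu, smul_zero])
    (by
      rw [herm_real_smul_left, hy, herm_add_right, herm_real_smul_right, herm_real_smul_right, hzu,
        hzy, smul_zero, smul_zero, add_zero, smul_zero])
  refine ⟨C, hC, fun j => ?_⟩
  fin_cases j
  · exact ⟨1, hone, by rw [hone']; exact h0⟩
  · exact ⟨t • z, Submodule.smul_mem _ _ hzA, by rw [Matrix.smul_mulVec]; exact h1⟩
  · exact ⟨β⁻¹ • a₀ + (-(γ / (2 * β ^ 2))) • 1,
      Submodule.add_mem _ (Submodule.smul_mem _ _ ha₀) (Submodule.smul_mem _ _ hone), by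
      rw [Matrix.add_mulVec, Matrix.smul_mulVec, Matrix.smul_mulVec, hone']; exact h2⟩

/-- An irreducible unbounded group with real traces preserves a real plane. -/
theorem exists_SO21_of_irreducible {G : Subgroup (GL (Fin 3) ℍ[ℝ])} (hG : G ≤ Sp21)
    (hunb : ∀ K : ℝ, ∃ g ∈ G, ∃ i j, K < ‖g.val i j‖) (htr : ∀ g ∈ G, HasRealTrace g)
    (hirr : ∀ v : Fin 3 → ℍ[ℝ], v ≠ 0 → ¬ ∀ g ∈ G, ∃ h : ℍ[ℝ], g.val *ᵥ v = op h • v) :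
    ∃ C ∈ Sp21, LeavesInvariant G (C • stdRealPlane) ∧ ∀ g ∈ G, InSO21 (C⁻¹ * g * C) := by
  have hbasis : ∀ v : Fin 3 → ℍ[ℝ], v ≠ 0 → ∃ P Q : Matrix (Fin 3) (Fin 3) ℍ[ℝ],
      P * Q = 1 ∧ Q * P = 1 ∧ ∀ j, ∃ a ∈ realSpan G, P.col j = a *ᵥ v := fun v hv => by
    obtain ⟨P, Q, hPQ, hQP, hP⟩ := exists_invertible_of_span_eq_top (span_orbit_eq_top hG hirr hv)
    refine ⟨P, Q, hPQ, hQP, fun j => ?_⟩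
    obtain ⟨g, hg, hgj⟩ := hP j
    exact ⟨g.val, val_mem_realSpan hg, hgj⟩
  obtain ⟨u, r, hu, hr, huu, hX⟩ := exists_rank_one hG hunb
  have hmul : ∀ a ∈ realSpan G, ∀ b ∈ realSpan G, a * b ∈ realSpan G :=
    fun a ha b hb => mul_mem_realSpan ha hb
  obtain ⟨d, hd, hreal⟩ := exists_left_factor_real hmul (fun a ha => adj_mem_realSpan hG ha)
    (fun a ha => trace_real_of_mem_realSpan htr ha) hbasis hu hr hX
  obtain ⟨hreal', C, hC, hcol⟩ := exists_real_frame (val_mem_realSpan G.one_mem) hbasis hu huu hd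
    hreal
  refine ⟨C, hC, exists_SO21_of_real hG hC fun g hg i j => ?_⟩
  obtain ⟨a, ha, haj⟩ := hcol j
  obtain ⟨b, hb, hbi⟩ := hcol i.rev
  rw [conj_apply hC, haj, hbi, Matrix.mulVec_mulVec]
  exact hreal' _ (hmul _ (val_mem_realSpan hg) _ ha) _ hb

end QuatHyp

end

theorem theorem1p3 (G : Subgroup (GL (Fin 3) ℍ[ℝ]))
    (hK : QuatHyp.IsKleinian G)
    (hne : ¬ QuatHyp.IsElementary G)
    (htr : ∀ g ∈ G, QuatHyp.HasRealTrace g) :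
    QuatHyp.IsFuchsian G ∧
      ∃ C ∈ QuatHyp.Sp21,
        (QuatHyp.LeavesInvariant G (C • QuatHyp.stdQuaternionicLine) ∧
          ∀ g ∈ G, QuatHyp.IsBlock (C⁻¹ * g * C)) ∨
        (QuatHyp.LeavesInvariant G (C • QuatHyp.stdRealPlane) ∧
          ∀ g ∈ G, QuatHyp.InSO21 (C⁻¹ * g * C)) := by
  by_cases hfix : ∃ v : Fin 3 → ℍ[ℝ], v ≠ 0 ∧
      ∀ g ∈ G, ∃ h : ℍ[ℝ], g.val *ᵥ v = MulOpposite.op h • v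
  · obtain ⟨v, hv0, hv⟩ := hfix
    rcases lt_trichotomy (QuatHyp.herm v v).re 0 with h | h | h
    · refine absurd ?_ hne
      rw [QuatHyp.IsElementary, QuatHyp.limitSet_eq_empty_of_fixed_negative hK.1 h hv]
      simp
    · refine absurd (QuatHyp.isElementary_of_fixed_null hK hv0 ?_ hv) hne
      rw [QuatHyp.herm_self_eq_coe, h, Quaternion.coe_zero]
    · obtain ⟨C, hC, hinv, hblock⟩ := QuatHyp.exists_block_of_fixed_pos hK.1 h hv
      exact ⟨⟨_, ⟨C, hC, Or.inl rfl⟩, hinv⟩, C, hC, Or.inl ⟨hinv, hblock⟩⟩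
  · have hunb : ∀ K : ℝ, ∃ g ∈ G, ∃ i j, K < ‖g.val i j‖ := by
      by_contra! h
      obtain ⟨K, hKb⟩ := h
      refine hne ?_
      rw [QuatHyp.IsElementary, QuatHyp.limitSet_eq_empty_of_bounded hK.1 K hKb]
      simp
    obtain ⟨C, hC, hinv, hreal⟩ := QuatHyp.exists_SO21_of_irreducible hK.1 hunb htr
      fun v hv0 hv => hfix ⟨v, hv0, hv⟩
    exact ⟨⟨_, ⟨C, hC, Or.inr (Or.inr (Or.inr rfl))⟩, hinv⟩, C, hC, Or.inr ⟨hinv, hreal⟩⟩
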